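/- Let $\Bbbk$ be a field of characteristic zero, let $a<0<b$ be integers, and let $B=(b_{ij})=\begin{bmatrix}0&b\\a&0\end{bmatrix}$. **Setup.** Let $\delta_1,\delta_2>0$ be such that $d_i=\delta_i^{-1}$ are integers with $\gcd(d_1,d_2)=1$ and $\delta_ib_{ij}=-\delta_jb_{ji}$. Let $V=\mathbb R^2$ have basis the simple roots $\alpha_1,\alpha_2$ (spanning the root lattice $Q$), put $\alpha_i^\vee=d_i\alpha_i$ (spanning the co-root lattice $Q^\vee$), let $\rho_1,\rho_2\in V^*$ be the basis dual to $\alpha_1^\vee,\alpha_2^\vee$ (spanning the weight lattice $P$), and let $\omega$ be the skew-symmetric form on $V$ with $\omega(\alpha_i^\vee,\alpha_j)=b_{ij}$. Write $Q^+$ for the set of nonzero vectors $\sum c_i\alpha_i$ with integers $c_i\ge0$, $x^\lambda y^\beta=x_1^{l_1}x_2^{l_2}y_1^{c_1}y_2^{c_2}$ for $\lambda=\sum l_i\rho_i$, $\beta=\sum c_i\alpha_i$, and $\hat y_i=y_ix_1^{b_{1i}}x_2^{b_{2i}}$. For primitive $\beta\in Q^+$, $\beta^\vee$ is the primitive vector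 of $Q^\vee$ that is a positive multiple of $\beta$. Let $\mathfrak m$ be the ideal of series with zero constant term in $\Bbbk[[x_1,x_2,\hat y_1,\hat y_2]]$. A *wall* $(\mathfrak d,f)$ is a rational polyhedral cone $\mathfrak d\subset V^*$ of codimension one contained in $\beta^\perp$ for a primitive $\beta\in Q^+$, with a series $f\in\Bbbk[[\hat y^\beta]]$ of constant term $1$; it is *outgoing* if $\omega(\cdot,\beta)\notin\mathfrak d$. A *scattering diagram* is a family of walls only finitely many of which are nontrivial modulo $\mathfrak m^{N+1}$, for every $N$. A path $\gamma:[0,1]\to V^*$ is *generic* if it is piecewise differentiable, avoids the relative boundaries of walls and the intersections of non-parallel walls, has endpoints on no wall, and crosses walls transversely. Crossing $(\mathfrak d,f)$ at time $t$ acts by $x^\lambda\mapsto x^\lambda f^{\langle\lambda,\pm\beta^\vee\rangle}$, $\hat y^\phi\mapsto\hat y^\phi f^{\omega(\pm\beta^\vee,\phi)}$, with sign $+$ if $\langle\gamma'(t),\beta\rangle<0$ and $-$ if it is $>0$; the path-ordered product of $\gamma$ is the limit, as $N\to\infty$, of the compositions in order of time of these automorphisms for the walls nontrivial modulo $\mathfrak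 m^{N+1}$. The diagram is *consistent* if the path-ordered product of a generic path depends only on the endpoints of the path. Let $\mathfrak D=\operatorname{Scat}^T(B)$ be the transposed cluster scattering diagram with principal coefficients, i.e. any consistent scattering diagram obtained from $\{(\alpha_1^\perp,1+\hat y_1),(\alpha_2^\perp,1+\hat y_2)\}$ by appending outgoing walls. Fix $p\in V^*$ with $\langle p,\alpha_1\rangle,\langle p,\alpha_2\rangle\ge0$ that lies on no hyperplane $\beta^\perp$ with $0\ne\beta\in Q$. A *broken line* for $\lambda\in P$ with endpoint $p$ is a piecewise linear path $\gamma:(-\infty,0]\to V^*$ with finitely many domains of linearity $L$, each carrying a monomial $c_Lx^{\lambda_L}y^{\beta_L}$, such that: $\gamma(0)=p$; $\gamma$ avoids the relative boundaries of walls and the intersections of non-parallel walls; $\gamma'=-\lambda_L$ on $L$; the monomial on the unbounded domain is $x^\lambda$; and at each point $\gamma(t)$ of nonlinearity, from $L$ to $L'$, there is a primitive $\beta^\vee\in Q^\vee$ normal to all walls containing $\gamma(t)$ with $\langle\lambda_L,\beta^\vee\rangle>0$, and $c_{L'}x^{\lambda_{L'}}y^{\beta_{L'}}$ is $c_Lx^{\lambda_L}y^{\beta_L}$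 times a nonzero term of $f^{\langle\lambda_L,\beta^\vee\rangle}$, where $f$ is the product of the functions on all walls containing $\gamma(t)$. The *theta function* $\vartheta_\lambda$ is the sum, over all broken lines for $\lambda$ with endpoint $p$, of their final monomials (so $\vartheta_0=1$). **Proposition.** Let $m_1,m_2$ be integers with $-b\le m_1\le0$ and $m_2\ge0$, and write $[x]_+=\max(x,0)$. Then, for every such $\mathfrak D$ and $p$, there are only finitely many broken lines for $m_1\rho_1+m_2\rho_2$ with endpoint $p$, and $$\vartheta_{m_1\rho_1+m_2\rho_2}=\sum_{i=0}^{-m_1}\binom{-m_1}{i}y_1^i\,x_1^{m_1}x_2^{m_2+ai}\,(1+y_2x_1^b)^{[-m_2-ai]_+}=\sum_{i=0}^{-m_1}\binom{-m_1}{i}y_1^i\,x_0^{[-m_2-ai]_+}x_1^{m_1}x_2^{[m_2+ai]_+},$$ where $x_0$ is the cluster variable obtained by exchanging $x_2$ from the initial cluster $\{x_1,x_2\}$ of the cluster algebra with principal coefficients with extended exchange matrix $\begin{bmatrix}B\\I\end{bmatrix}$, and $x_0=\dfrac{1+y_2x_1^b}{x_2}$. -/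

import Mathlib

noncomputable section

namespace ClusterScattering

open Filter

/-!
Coordinates.  Fix an `n × n` exchange matrix `B` and positive integers `d i = δ_i⁻¹`.
* An element `∑ c_i α_i` of the root lattice `Q` is the vector `c : Fin n → ℤ` (or `Fin n → ℕ` when it
  is nonnegative); an element `∑ e_i α_i^∨ = ∑ e_i d_i α_i` of the co-root lattice `Q^∨` is the vector `e`.
* A point `∑ q_i ρ_i` of `V^*` is the vector `q : Fin n → ℝ`, where the fundamental weights `ρ_i` are dual
  to the simple co-roots `α_i^∨`; an element of the weight lattice `P` is an integer vector.
-/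

/-- The integers `d i = δ_i⁻¹` skew-symmetrize `B`: they are positive, have greatest common divisor `1`, and
`δ_i b_{ij} = - δ_j b_{ji}`. -/
structure IsSkewSymmetrizer {n : ℕ} (B : Matrix (Fin n) (Fin n) ℤ) (d : Fin n → ℕ) : Prop where
  pos : ∀ i, 0 < d i
  gcd_eq_one : Finset.univ.gcd d = 1
  skew : ∀ i j, (d j : ℤ) * B i j = -((d i : ℤ) * B j i)

/-- The pairing `⟨q, β⟩` of `q ∈ V^*` with `β = ∑ c_i α_i`; here `⟨ρ_i, α_j⟩ = δ_j` if `i = j` and `0`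
otherwise. -/
def rootPairing {n : ℕ} (d : Fin n → ℕ) (q : Fin n → ℝ) (c : Fin n → ℤ) : ℝ :=
  ∑ i, (c i : ℝ) * (q i / (d i : ℝ))

/-- A vector of the root lattice with nonnegative coordinates, as a vector with integer coordinates. -/
def toQ {n : ℕ} (β : Fin n → ℕ) : Fin n → ℤ := fun i => (β i : ℤ)

/-- The hyperplane `β^⊥` in `V^*`. -/
def hyperplane {n : ℕ} (d : Fin n → ℕ) (β : Fin n → ℕ) : Set (Fin n → ℝ) :=
  {q | rootPairing d q (toQ β) = 0}

/-- `β^∨`: the coordinates, in the basis of simple co-roots, of the primitive vector of `Q^∨` that is a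
positive multiple of `β = ∑ β_i α_i = ∑ (β_i / d_i) α_i^∨`. -/
def coroot {n : ℕ} (d : Fin n → ℕ) (β : Fin n → ℕ) : Fin n → ℤ := fun i =>
  (((β i * ∏ j ∈ Finset.univ.erase i, d j) /
    Finset.univ.gcd (fun l => β l * ∏ j ∈ Finset.univ.erase l, d j) : ℕ) : ℤ)

/-- A wall `(𝔡, f)`: a rational polyhedral cone `𝔡` of codimension one contained in `β^⊥`, with `β` primitive
in `Q⁺`, and a power series `f ∈ k[[ŷ^β]] ⊆ k[[ŷ_1, …, ŷ_n]]` with constant term `1`. -/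
structure Wall (k : Type*) [Field k] {n : ℕ} (d : Fin n → ℕ) where
  carrier : Set (Fin n → ℝ)
  root : Fin n → ℕ
  fn : MvPowerSeries (Fin n) k
  root_primitive : Finset.univ.gcd root = 1
  isCone : ∃ Φ : Finset (Fin n → ℤ),
    carrier = {q | q ∈ hyperplane d root ∧ ∀ φ ∈ Φ, rootPairing d q φ ≤ 0}
  codim_one : Module.finrank ℝ (Submodule.span ℝ carrier) + 1 = n
  fn_support : ∀ e : Fin n →₀ ℕ, MvPowerSeries.coeff e fn ≠ 0 → ∃ m : ℕ, ∀ i, e i = m * root i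
  fn_constantCoeff : MvPowerSeries.constantCoeff fn = 1

/-- The element `ω(·, β)` of `V^*`, whose pairing with `α_i^∨` is `ω(α_i^∨, β) = ∑_j b_{ij} β_j`. -/
def omegaVec {n : ℕ} (B : Matrix (Fin n) (Fin n) ℤ) (β : Fin n → ℕ) : Fin n → ℤ :=
  B.mulVec (toQ β)

/-- A wall is outgoing if `ω(·, β)` is not in it. -/
def Wall.Outgoing {k : Type*} [Field k] {n : ℕ} {d : Fin n → ℕ} (B : Matrix (Fin n) (Fin n) ℤ)
    (w : Wall k d) : Prop :=
  (fun i => ((omegaVec B w.root i : ℤ) : ℝ)) ∉ w.carrier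

/-- `f ≢ 1` modulo `𝔪^{N+1}`. -/
def Wall.NontrivialMod {k : Type*} [Field k] {n : ℕ} {d : Fin n → ℕ} (w : Wall k d) (N : ℕ) : Prop :=
  ∃ e : Fin n →₀ ℕ, e.degree ≤ N ∧
    MvPowerSeries.coeff e w.fn ≠ MvPowerSeries.coeff e (1 : MvPowerSeries (Fin n) k)

/-- The wall is the initial wall `(α_i^⊥, 1 + ŷ_i)`. -/
def Wall.IsInitial {k : Type*} [Field k] {n : ℕ} {d : Fin n → ℕ} (w : Wall k d) (i : Fin n) : Prop :=
  w.root = Pi.single i 1 ∧ w.carrier = hyperplane d (Pi.single i 1) ∧ w.fn = 1 + MvPowerSeries.X i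

/-- A scattering diagram: a family of walls of which, for each `N`, only finitely many are nontrivial
modulo `𝔪^{N+1}`. -/
structure ScatteringDiagram (k : Type*) [Field k] {n : ℕ} (d : Fin n → ℕ) (ι : Type*) where
  wall : ι → Wall k d
  finite : ∀ N : ℕ, {i | (wall i).NontrivialMod N}.Finite

/-- Integer powers of a power series with nonzero constant term. -/
def zpowSeries {k : Type*} [Field k] {σ : Type*} (f : MvPowerSeries σ k) (m : ℤ) : MvPowerSeries σ k :=
  if 0 ≤ m then f ^ m.toNat else f⁻¹ ^ (-m).toNat

/-- The ring `k[[x_1, …, x_n, ŷ_1, …, ŷ_n]]`. -/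
abbrev XYSeries (k : Type*) [Field k] (n : ℕ) := MvPowerSeries (Fin n ⊕ Fin n) k

/-- The wall-crossing automorphism for the sign `s = ±1`, given by `x_i ↦ x_i f^{⟨ρ_i, s β^∨⟩}` and
`ŷ_j ↦ ŷ_j f^{ω(s β^∨, α_j)}`. -/
def Wall.crossing {k : Type*} [Field k] {n : ℕ} {d : Fin n → ℕ} (B : Matrix (Fin n) (Fin n) ℤ)
    (w : Wall k d) (s : ℤ) (g : XYSeries k n) : XYSeries k n :=
  MvPowerSeries.subst
    (Sum.elim
      (fun i => MvPowerSeries.X (Sum.inl i) *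
        zpowSeries (MvPowerSeries.rename Sum.inr w.fn) (s * coroot d w.root i))
      (fun j => MvPowerSeries.X (Sum.inr j) *
        zpowSeries (MvPowerSeries.rename Sum.inr w.fn) (s * Matrix.vecMul (coroot d w.root) B j)) :
      Fin n ⊕ Fin n → XYSeries k n) g

/-- The path `γ : [0,1] → V^*` is piecewise differentiable. -/
structure IsPiecewiseDifferentiable {n : ℕ} (γ : ℝ → Fin n → ℝ) : Prop where
  continuousOn : ContinuousOn γ (Set.Icc 0 1)
  right : ∀ t ∈ Set.Ico (0 : ℝ) 1, DifferentiableWithinAt ℝ γ (Set.Ici t) t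
  left : ∀ t ∈ Set.Ioc (0 : ℝ) 1, DifferentiableWithinAt ℝ γ (Set.Iic t) t
  finite : {t | t ∈ Set.Ioo (0 : ℝ) 1 ∧ ¬ DifferentiableAt ℝ γ t}.Finite

/-- A generic path for a scattering diagram.  Transversality asks that the left and right derivatives point
strictly to the same side of the wall. -/
structure IsGenericPath {k : Type*} [Field k] {n : ℕ} {d : Fin n → ℕ} {ι : Type*}
    (D : ScatteringDiagram k d ι) (γ : ℝ → Fin n → ℝ) : Prop where
  piecewise : IsPiecewiseDifferentiable γ
  avoids_intersections : ∀ i j, (D.wall i).root ≠ (D.wall j).root →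
    ∀ t ∈ Set.Icc (0 : ℝ) 1, γ t ∉ (D.wall i).carrier ∩ (D.wall j).carrier
  avoids_boundaries : ∀ i, ∀ t ∈ Set.Icc (0 : ℝ) 1, γ t ∉ intrinsicFrontier ℝ (D.wall i).carrier
  start_notMem : ∀ i, γ 0 ∉ (D.wall i).carrier
  end_notMem : ∀ i, γ 1 ∉ (D.wall i).carrier
  transverse : ∀ i, ∀ t ∈ Set.Ioo (0 : ℝ) 1, γ t ∈ (D.wall i).carrier →
    0 < rootPairing d (derivWithin γ (Set.Iic t) t) (toQ (D.wall i).root) *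
      rootPairing d (derivWithin γ (Set.Ici t) t) (toQ (D.wall i).root)

/-- The sign in `±β^∨`: `+1` if `⟨γ'(t), β⟩ < 0` and `-1` if `⟨γ'(t), β⟩ > 0`. -/
def crossingSign {n : ℕ} (d : Fin n → ℕ) (γ : ℝ → Fin n → ℝ) (t : ℝ) (β : Fin n → ℕ) : ℤ :=
  if rootPairing d (derivWithin γ (Set.Ici t) t) (toQ β) < 0 then 1 else -1

/-- `l` lists, in weakly increasing order of time, the pairs `(wall, time)` at which `γ` crosses a wall that is
nontrivial modulo `𝔪^{N+1}`. -/
structure IsCrossingList {k : Type*} [Field k] {n : ℕ} {d : Fin n → ℕ} {ι : Type*}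
    (D : ScatteringDiagram k d ι) (γ : ℝ → Fin n → ℝ) (N : ℕ) (l : List (ι × ℝ)) : Prop where
  nodup : l.Nodup
  mem_iff : ∀ i t, (i, t) ∈ l ↔
    (D.wall i).NontrivialMod N ∧ t ∈ Set.Icc (0 : ℝ) 1 ∧ γ t ∈ (D.wall i).carrier
  sorted : l.Pairwise (fun c c' => c.2 ≤ c'.2)

/-- The composition of the wall-crossing automorphisms in a list of crossings; the first crossing in the list
is applied first. -/
def crossingProduct {k : Type*} [Field k] {n : ℕ} {d : Fin n → ℕ} {ι : Type*}
    (B : Matrix (Fin n) (Fin n) ℤ) (D : ScatteringDiagram k d ι) (γ : ℝ → Fin n → ℝ)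
    (l : List (ι × ℝ)) (g : XYSeries k n) : XYSeries k n :=
  l.foldl (fun h c =>
    (D.wall c.1).crossing B (crossingSign d γ c.2 (D.wall c.1).root) h) g

/-- `F` is the path-ordered product `𝔭_{γ,D}`: the coefficientwise limit, as `N → ∞`, of the compositions of the
wall-crossing automorphisms of the walls that are nontrivial modulo `𝔪^{N+1}`. -/
def IsPathOrderedProduct {k : Type*} [Field k] {n : ℕ} {d : Fin n → ℕ} {ι : Type*}
    (B : Matrix (Fin n) (Fin n) ℤ) (D : ScatteringDiagram k d ι) (γ : ℝ → Fin n → ℝ)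
    (F : XYSeries k n → XYSeries k n) : Prop :=
  ∀ (g : XYSeries k n) (e : Fin n ⊕ Fin n →₀ ℕ), ∀ᶠ N : ℕ in atTop,
    ∀ l, IsCrossingList D γ N l →
      MvPowerSeries.coeff e (crossingProduct B D γ l g) = MvPowerSeries.coeff e (F g)

/-- A scattering diagram is consistent if the path-ordered product along a generic path depends only on the
endpoints of the path. -/
def ScatteringDiagram.Consistent {k : Type*} [Field k] {n : ℕ} {d : Fin n → ℕ} {ι : Type*}
    (B : Matrix (Fin n) (Fin n) ℤ) (D : ScatteringDiagram k d ι) : Prop :=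
  ∀ γ γ' : ℝ → Fin n → ℝ, IsGenericPath D γ → IsGenericPath D γ' → γ 0 = γ' 0 → γ 1 = γ' 1 →
    ∃ F, IsPathOrderedProduct B D γ F ∧ IsPathOrderedProduct B D γ' F

/-- `D` is (a representative of) the transposed cluster scattering diagram with principal coefficients
`Scat^T(B)`: it is consistent and is obtained from the initial scattering diagram
`{(α_i^⊥, 1 + ŷ_i) : i = 1, …, n}` by appending outgoing walls. -/
structure IsTransposedClusterScattering {k : Type*} [Field k] {n : ℕ} {d : Fin n → ℕ} {ι : Type*}
    (B : Matrix (Fin n) (Fin n) ℤ) (D : ScatteringDiagram k d ι) : Prop where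
  consistent : D.Consistent B
  initial : ∃ ini : Fin n ↪ ι, (∀ i, (D.wall (ini i)).IsInitial i) ∧
    ∀ j, j ∉ Set.range ini → (D.wall j).Outgoing B

/-- The (possibly infinite) product of the functions `f` on all walls that contain the point `q`.  Its
coefficient in degree `N` only involves the walls that are nontrivial modulo `𝔪^{N+1}`. -/
def ScatteringDiagram.localFn {k : Type*} [Field k] {n : ℕ} {d : Fin n → ℕ} {ι : Type*}
    (D : ScatteringDiagram k d ι) (q : Fin n → ℝ) : MvPowerSeries (Fin n) k := fun e =>
  MvPowerSeries.coeff e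
    (∏ᶠ i ∈ {i | (D.wall i).NontrivialMod e.degree ∧ q ∈ (D.wall i).carrier}, (D.wall i).fn)

/-- A broken line for the weight `lam` with endpoint `p`.  It is a path `(-∞, 0] → V^*` with `bends` points of
nonlinearity `time 0 < time 1 < … < 0`, hence with `bends + 1` domains of linearity, and to the domain of
linearity number `i` is attached the monomial `coeff i • x^(wt i) y^(rt i)`. -/
@[ext]
structure BrokenLine {k : Type*} [Field k] {n : ℕ} {d : Fin n → ℕ} {ι : Type*}
    (B : Matrix (Fin n) (Fin n) ℤ) (D : ScatteringDiagram k d ι) (p : Fin n → ℝ) (lam : Fin n → ℤ) where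
  bends : ℕ
  time : Fin bends → ℝ
  coeff : Fin (bends + 1) → k
  wt : Fin (bends + 1) → Fin n → ℤ
  rt : Fin (bends + 1) → Fin n → ℤ
  path : Set.Iic (0 : ℝ) → Fin n → ℝ
  time_strictMono : StrictMono time
  time_neg : ∀ j, time j < 0
  /-- The broken line ends at `p`. -/
  path_zero : path ⟨0, Set.mem_Iic.2 le_rfl⟩ = p
  /-- The path avoids the relative boundaries of walls and the intersections of non-parallel walls. -/
  avoids_boundaries : ∀ s i, path s ∉ intrinsicFrontier ℝ (D.wall i).carrier
  avoids_intersections : ∀ s i j, (D.wall i).root ≠ (D.wall j).root →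
    path s ∉ (D.wall i).carrier ∩ (D.wall j).carrier
  /-- In the domain of linearity number `i`, the path has derivative `- wt i`. -/
  linear : ∀ (i : Fin (bends + 1)) (s s' : Set.Iic (0 : ℝ)),
    (∀ j : Fin bends, (j : ℕ) < i → time j ≤ s ∧ time j ≤ s') →
    (∀ j : Fin bends, (i : ℕ) ≤ j → (s : ℝ) ≤ time j ∧ (s' : ℝ) ≤ time j) →
    ∀ l, path s' l - path s l = ((s' : ℝ) - s) * (-(wt i l : ℝ))
  /-- The monomial on the unbounded domain of linearity is `x^lam`. -/
  initial : coeff 0 = 1 ∧ wt 0 = lam ∧ rt 0 = 0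
  /-- The path is not linear at `time j`. -/
  nonlinear : ∀ j : Fin bends, wt j.castSucc ≠ wt j.succ
  /-- At the point of nonlinearity number `j`, with `v = β^∨` primitive in `Q^∨` and normal to all walls
  through that point, and `⟨λ_L, β^∨⟩ > 0`, the monomial is multiplied by a (nonzero) term `c ŷ^e` of
  `f^⟨λ_L, β^∨⟩`, where `ŷ^e = x^{Be} y^e`. -/
  bend : ∀ j : Fin bends, ∃ v : Fin n → ℤ, Finset.univ.gcd v = 1 ∧
    (∀ i, path ⟨time j, Set.mem_Iic.2 (time_neg j).le⟩ ∈ (D.wall i).carrier →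
      ∀ q ∈ (D.wall i).carrier, ∑ l, q l * (v l : ℝ) = 0) ∧
    0 < ∑ l, wt j.castSucc l * v l ∧
    ∃ e : Fin n →₀ ℕ, ∃ c : k, c ≠ 0 ∧
      c = MvPowerSeries.coeff e
        (D.localFn (path ⟨time j, Set.mem_Iic.2 (time_neg j).le⟩) ^ (∑ l, wt j.castSucc l * v l).toNat) ∧
      coeff j.succ = coeff j.castSucc * c ∧
      wt j.succ = wt j.castSucc + omegaVec B e ∧
      rt j.succ = rt j.castSucc + toQ e

/-- The endpoint `p` lies in the dominant chamber and on no hyperplane `β^⊥` with `β ∈ Q` nonzero. -/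
def IsGenericEndpoint {n : ℕ} (d : Fin n → ℕ) (p : Fin n → ℝ) : Prop :=
  (∀ i, 0 ≤ rootPairing d p (Pi.single i 1)) ∧ ∀ c : Fin n → ℤ, c ≠ 0 → rootPairing d p c ≠ 0

/-- The theta function `ϑ_lam` computed with endpoint `p`: the formal sum, over all broken lines for `lam` with
endpoint `p`, of their final monomials `c x^μ y^ν`.  It is given by its coefficients: the value at
`(μ, ν)` is the coefficient of `x^μ y^ν`. -/
def theta {k : Type*} [Field k] {n : ℕ} {d : Fin n → ℕ} {ι : Type*}
    (B : Matrix (Fin n) (Fin n) ℤ) (D : ScatteringDiagram k d ι) (p : Fin n → ℝ) (lam : Fin n → ℤ) :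
    (Fin n → ℤ) × (Fin n → ℤ) → k := fun e =>
  ∑ᶠ γ : {γ : BrokenLine B D p lam // (γ.wt (Fin.last _), γ.rt (Fin.last _)) = e},
    γ.1.coeff (Fin.last _)

/-- The Laurent polynomial ring `k[x_1^{±1}, …, x_n^{±1}, y_1^{±1}, …, y_n^{±1}]`. -/
abbrev LaurentRing (k : Type*) [Field k] (n : ℕ) := AddMonoidAlgebra k ((Fin n → ℤ) × (Fin n → ℤ))

/-- The Laurent monomial `x^lam y^β`. -/
def monomial (k : Type*) [Field k] {n : ℕ} (lam β : Fin n → ℤ) : LaurentRing k n :=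
  AddMonoidAlgebra.single (lam, β) 1

/-- The extended cluster `(x_1, …, x_n, y_1, …, y_n)` of the initial seed. -/
def extendedCluster (k : Type*) [Field k] {n : ℕ} : Fin n ⊕ Fin n → LaurentRing k n :=
  Sum.elim (fun i => monomial k (Pi.single i 1) 0) (fun j => monomial k 0 (Pi.single j 1))

/-- The cluster variable obtained by exchanging `x_r` from the initial cluster of the cluster algebra with
principal coefficients, whose extended exchange matrix is `B` on top of the identity matrix. -/
def exchangedVariable (k : Type*) [Field k] {n : ℕ} (B : Matrix (Fin n) (Fin n) ℤ) (r : Fin n) :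
    LaurentRing k n :=
  monomial k (-Pi.single r 1) 0 *
    (∏ i, extendedCluster k i ^ (Matrix.fromRows B 1 i r).toNat +
      ∏ i, extendedCluster k i ^ (-(Matrix.fromRows B 1 i r)).toNat)

end ClusterScattering

end

open ClusterScattering

/-! Indices start at 0, as in the code. By skew-symmetry the vector ω(·, β) = (b β_1, a β_0) lies on
the line β^⊥, so an outgoing wall is confined to the closed second quadrant q_0 ≤ 0 ≤ q_1. A broken
line ending at p, in the open first quadrant, hardly sees that quadrant; three facts about the
product of the wall functions at a point suffice.

On the half-plane q_0 > 0 only the initial wall q_1 = 0 occurs, with function 1 + ŷ_1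
(`localFn_of_one_eq_zero`, `localFn_of_pos`).

On the axis q_0 = 0, away from the origin, the product is 1 + ŷ_0 (`localFn_of_zero_eq_zero`). Below
the origin this is the initial wall alone. Above it other walls with root α_0 may be present;
consistency for two paths passing the origin on opposite sides, applied to x_0 and read modulo ŷ_1,
shows that the two halves of the axis carry the same product.

On q_0 < 0 the product is 1 modulo ŷ_1. A bend there raises the exponent of x_0 by at least b, hence
to a nonnegative value because -b ≤ m₁. That exponent never decreases, and the velocity is minus the
weight, so the line could never return to p_0 > 0 (`BrokenLine.bendPoint_zero_nonneg`).

What remains is an optional bend on q_0 = 0, choosing ŷ_0^x from (1 + ŷ_0)^(-m₁), followed by an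
optional bend on q_1 = 0, choosing ŷ_1^y from (1 + ŷ_1)^(-m₂ - a x). Tracing back from p gives
uniqueness for each pair (x, y) (`BrokenLine.classification`) and existence (`exists_brokenLine`):
characteristic zero keeps the binomial coefficients nonzero, and genericity of p keeps the line off
the origin, the only possible relative boundary or intersection point. Summing over y is the
binomial theorem. -/

namespace ClusterScattering

open Filter

/-! ### Pairings and cones -/

section Geometry

variable {k : Type*} [Field k]

theorem rootPairing_smul {n : ℕ} (d : Fin n → ℕ) (r : ℝ) (q : Fin n → ℝ) (c : Fin n → ℤ) :
    rootPairing d (r • q) c = r * rootPairing d q c := by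
  simp only [rootPairing, Finset.mul_sum, Pi.smul_apply, smul_eq_mul]
  exact Finset.sum_congr rfl fun i _ => by ring

theorem rootPairing_add {n : ℕ} (d : Fin n → ℕ) (q q' : Fin n → ℝ) (c : Fin n → ℤ) :
    rootPairing d (q + q') c = rootPairing d q c + rootPairing d q' c := by
  simp only [rootPairing, ← Finset.sum_add_distrib, Pi.add_apply]
  exact Finset.sum_congr rfl fun i _ => by ring

theorem continuous_rootPairing {n : ℕ} (d : Fin n → ℕ) (c : Fin n → ℤ) :
    Continuous fun q : Fin n → ℝ => rootPairing d q c := by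
  unfold rootPairing
  fun_prop

theorem Wall.smul_mem {n : ℕ} {d : Fin n → ℕ} (w : Wall k d) {q : Fin n → ℝ} (hq : q ∈ w.carrier)
    {r : ℝ} (hr : 0 ≤ r) : r • q ∈ w.carrier := by
  obtain ⟨Φ, hΦ⟩ := w.isCone
  rw [hΦ] at hq ⊢
  refine ⟨?_, fun φ hφ => ?_⟩
  · have := hq.1
    simp only [hyperplane, Set.mem_ofPred_eq] at this ⊢
    rw [rootPairing_smul, this, mul_zero]
  · rw [rootPairing_smul]
    exact mul_nonpos_of_nonneg_of_nonpos hr (hq.2 φ hφ)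

theorem Wall.isClosed_carrier {n : ℕ} {d : Fin n → ℕ} (w : Wall k d) : IsClosed w.carrier := by
  obtain ⟨Φ, hΦ⟩ := w.isCone
  rw [hΦ]
  refine IsClosed.inter (isClosed_eq (continuous_rootPairing d _) continuous_const) ?_
  change IsClosed {q : Fin n → ℝ | ∀ φ ∈ Φ, rootPairing d q φ ≤ 0}
  have : {q : Fin n → ℝ | ∀ φ ∈ Φ, rootPairing d q φ ≤ 0} =
      ⋂ φ, ⋂ (_ : φ ∈ Φ), {q | rootPairing d q φ ≤ 0} := by
    ext
    simp
  exact this.symm ▸ isClosed_iInter fun φ => isClosed_iInter fun _ =>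
    isClosed_le (continuous_rootPairing d _) continuous_const

theorem Wall.rootPairing_eq_zero {n : ℕ} {d : Fin n → ℕ} (w : Wall k d) {q : Fin n → ℝ}
    (hq : q ∈ w.carrier) : rootPairing d q (toQ w.root) = 0 := by
  obtain ⟨Φ, hΦ⟩ := w.isCone
  rw [hΦ] at hq
  exact hq.1

theorem rootPairing_fin_two (d : Fin 2 → ℕ) (q : Fin 2 → ℝ) (c : Fin 2 → ℤ) :
    rootPairing d q c = c 0 * (q 0 / d 0) + c 1 * (q 1 / d 1) := by
  simp [rootPairing, Fin.sum_univ_two]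

variable {d : Fin 2 → ℕ} (hd : ∀ i, 0 < d i)
include hd

theorem rootPairing_toQ_eq_zero_iff (q : Fin 2 → ℝ) (β : Fin 2 → ℕ) :
    rootPairing d q (toQ β) = 0 ↔ (β 0 : ℝ) * d 1 * q 0 + β 1 * d 0 * q 1 = 0 := by
  have h0 : (d 0 : ℝ) ≠ 0 := by exact_mod_cast (hd 0).ne'
  have h1 : (d 1 : ℝ) ≠ 0 := by exact_mod_cast (hd 1).ne'
  rw [rootPairing_fin_two]
  simp only [toQ, Int.cast_natCast]
  field_simp
  constructor <;> intro h <;> linear_combination h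

end Geometry

theorem Wall.root_gcd {k : Type*} [Field k] {d : Fin 2 → ℕ} (w : Wall k d) :
    Nat.Coprime (w.root 0) (w.root 1) := by
  have h := w.root_primitive
  rw [show (Finset.univ : Finset (Fin 2)) = {0, 1} from rfl] at h
  rw [Finset.gcd_insert, Finset.gcd_singleton, normalize_eq] at h
  exact h

theorem Wall.root_pos {k : Type*} [Field k] {d : Fin 2 → ℕ} (w : Wall k d) :
    0 < w.root 0 ∨ 0 < w.root 1 := by
  by_contra! h
  have := w.root_gcd
  rw [Nat.le_zero.1 h.1, Nat.le_zero.1 h.2] at this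
  simp at this

theorem Wall.root_eq_of_one_eq_zero {k : Type*} [Field k] {d : Fin 2 → ℕ} (w : Wall k d)
    (h : w.root 1 = 0) : w.root = Pi.single 0 1 := by
  have h' := w.root_gcd
  rw [h, Nat.coprime_zero_right] at h'
  funext i
  fin_cases i <;> simp [h, h']

/-! ### Walls in the plane -/

section Planar

variable {k : Type*} [Field k] {d : Fin 2 → ℕ} (hd : ∀ i, 0 < d i)
include hd

theorem parallel_of_rootPairing_eq_zero {q : Fin 2 → ℝ} {β : Fin 2 → ℕ}
    (hβ : 0 < β 0 ∨ 0 < β 1) (h : rootPairing d q (toQ β) = 0) {x : Fin 2 → ℝ}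
    (hx : rootPairing d x (toQ β) = 0) : x 0 * q 1 = x 1 * q 0 := by
  rw [rootPairing_toQ_eq_zero_iff hd] at h hx
  have h0 : (0 : ℝ) < d 0 := by exact_mod_cast hd 0
  have h1 : (0 : ℝ) < d 1 := by exact_mod_cast hd 1
  rcases hβ with hβ | hβ
  · have hb : (0 : ℝ) < β 0 := by exact_mod_cast hβ
    refine mul_left_cancel₀ (mul_pos hb h1).ne' ?_
    linear_combination q 1 * hx - x 1 * h
  · have hb : (0 : ℝ) < β 1 := by exact_mod_cast hβ
    refine mul_left_cancel₀ (mul_pos hb h0).ne' ?_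
    linear_combination -q 0 * hx + x 0 * h

omit hd in
theorem dotProduct_self_pos {q : Fin 2 → ℝ} (hq : q ≠ 0) : 0 < q 0 * q 0 + q 1 * q 1 := by
  by_contra! h
  refine hq (funext fun i => ?_)
  have h0 : q 0 = 0 := by nlinarith [mul_self_nonneg (q 0), mul_self_nonneg (q 1)]
  have h1 : q 1 = 0 := by nlinarith [mul_self_nonneg (q 0), mul_self_nonneg (q 1)]
  fin_cases i <;> simp [h0, h1]

/-- The only possible relative boundary point of a planar wall is the origin. -/
theorem Wall.intrinsicFrontier_subset (w : Wall k d) :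
    intrinsicFrontier ℝ w.carrier ⊆ {0} := by
  intro q hq
  have hqc : q ∈ w.carrier := _root_.intrinsicFrontier_subset w.isClosed_carrier hq
  by_contra hq0
  have hq0 : q ≠ 0 := hq0
  rw [mem_intrinsicFrontier] at hq
  obtain ⟨y, hy, rfl⟩ := hq
  refine hy.2 ?_
  have hpos := dotProduct_self_pos hq0
  rw [mem_interior]
  -- The affine span lies in the line through `y`; its points having positive inner product with `y`
  -- are positive multiples of `y`, hence in the cone.
  refine ⟨{x | 0 < (x : Fin 2 → ℝ) 0 * (y : Fin 2 → ℝ) 0 + (x : Fin 2 → ℝ) 1 * (y : Fin 2 → ℝ) 1},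
    ?_, ?_, hpos⟩
  · intro x hx
    have hxs : rootPairing d (x : Fin 2 → ℝ) (toQ w.root) = 0 := by
      have hsp : (x : Fin 2 → ℝ) ∈ Submodule.span ℝ w.carrier := affineSpan_subset_span x.2
      generalize (x : Fin 2 → ℝ) = x' at hsp
      induction hsp using Submodule.span_induction with
      | mem z hz => exact w.rootPairing_eq_zero hz
      | zero => simp [rootPairing]
      | add u v _ _ hu hv => rw [rootPairing_add, hu, hv, add_zero]
      | smul r u _ hu => rw [rootPairing_smul, hu, mul_zero]
    have hpar := parallel_of_rootPairing_eq_zero hd w.root_pos (w.rootPairing_eq_zero hqc) hxs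
    have hx' : 0 < (x : Fin 2 → ℝ) 0 * (y : Fin 2 → ℝ) 0 + (x : Fin 2 → ℝ) 1 * (y : Fin 2 → ℝ) 1 := hx
    have key : (x : Fin 2 → ℝ) = (((x : Fin 2 → ℝ) 0 * (y : Fin 2 → ℝ) 0 +
        (x : Fin 2 → ℝ) 1 * (y : Fin 2 → ℝ) 1) / ((y : Fin 2 → ℝ) 0 * (y : Fin 2 → ℝ) 0 +
        (y : Fin 2 → ℝ) 1 * (y : Fin 2 → ℝ) 1)) • (y : Fin 2 → ℝ) := by
      funext i
      simp only [Pi.smul_apply, smul_eq_mul]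
      rw [div_mul_eq_mul_div, eq_div_iff hpos.ne']
      fin_cases i
      · simp only [Fin.zero_eta]
        linear_combination (y : Fin 2 → ℝ) 1 * hpar
      · simp only [Fin.mk_one]
        linear_combination -(y : Fin 2 → ℝ) 0 * hpar
    have := w.smul_mem hqc (div_nonneg hx'.le hpos.le)
    rw [← key] at this
    exact this
  · have : Continuous fun x : affineSpan ℝ w.carrier =>
        (x : Fin 2 → ℝ) 0 * (y : Fin 2 → ℝ) 0 + (x : Fin 2 → ℝ) 1 * (y : Fin 2 → ℝ) 1 := by
      have hc : Continuous fun x : affineSpan ℝ w.carrier => (x : Fin 2 → ℝ) :=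
        continuous_subtype_val
      have h0 := (continuous_apply (0 : Fin 2)).comp hc
      have h1 := (continuous_apply (1 : Fin 2)).comp hc
      exact (h0.mul continuous_const).add (h1.mul continuous_const)
    exact isOpen_lt continuous_const this

/-- Nonparallel planar walls meet only in the origin. -/
theorem Wall.eq_zero_of_mem_inter (w w' : Wall k d) (h : w.root ≠ w'.root) {q : Fin 2 → ℝ}
    (hq : q ∈ w.carrier ∩ w'.carrier) : q = 0 := by
  by_contra hq0
  refine h ?_
  have h1 := w.rootPairing_eq_zero hq.1
  have h2 := w'.rootPairing_eq_zero hq.2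
  rw [rootPairing_toQ_eq_zero_iff hd] at h1 h2
  have hd0 : (0 : ℝ) < d 0 := by exact_mod_cast hd 0
  have hd1 : (0 : ℝ) < d 1 := by exact_mod_cast hd 1
  -- A common nonzero point makes the two roots proportional; primitive nonnegative vectors that are
  -- proportional coincide.
  have hR : (w.root 0 : ℝ) * w'.root 1 = w.root 1 * w'.root 0 := by
    have hne : q 0 ≠ 0 ∨ q 1 ≠ 0 := by
      by_contra! hh
      exact hq0 (funext fun i => by fin_cases i <;> simp [hh.1, hh.2])
    rcases hne with hne | hne
    · refine mul_left_cancel₀ (mul_ne_zero hd1.ne' hne) ?_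
      linear_combination w'.root 1 * h1 - w.root 1 * h2
    · refine mul_left_cancel₀ (mul_ne_zero hd0.ne' hne) ?_
      linear_combination -(w'.root 0 * h1) + w.root 0 * h2
  have hN : w.root 0 * w'.root 1 = w.root 1 * w'.root 0 := by exact_mod_cast hR
  have c := w.root_gcd
  have c' := w'.root_gcd
  have e0 : w.root 0 = w'.root 0 := Nat.dvd_antisymm
    (c.dvd_of_dvd_mul_left (Dvd.intro _ hN)) (c'.dvd_of_dvd_mul_right (Dvd.intro_left _ hN.symm))
  have e1 : w.root 1 = w'.root 1 := Nat.dvd_antisymm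
    (c.symm.dvd_of_dvd_mul_left (Dvd.intro _ hN.symm))
    (c'.symm.dvd_of_dvd_mul_right (Dvd.intro_left _ hN))
  funext i
  fin_cases i
  · exact e0
  · exact e1

/-- A root has nonnegative coordinates, not both zero, so pairing with it has a strict sign on the
open first and third quadrants. This keeps the endpoints of the test paths below off all walls. -/
theorem Wall.neg_or_pos_of_mem (w : Wall k d) {q : Fin 2 → ℝ} (hq : q ∈ w.carrier) :
    ¬ (0 < q 0 ∧ 0 < q 1) ∧ ¬ (q 0 < 0 ∧ q 1 < 0) := by
  have h := w.rootPairing_eq_zero hq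
  rw [rootPairing_toQ_eq_zero_iff hd] at h
  have hd0 : (0 : ℝ) < d 0 := by exact_mod_cast hd 0
  have hd1 : (0 : ℝ) < d 1 := by exact_mod_cast hd 1
  have r0 : (0 : ℝ) ≤ w.root 0 := Nat.cast_nonneg _
  have r1 : (0 : ℝ) ≤ w.root 1 := Nat.cast_nonneg _
  constructor
  · rintro ⟨a0, a1⟩
    rcases w.root_pos with hp | hp
    · have hp : (0 : ℝ) < w.root 0 := by exact_mod_cast hp
      have := mul_pos (mul_pos hp hd1) a0
      have := mul_nonneg (mul_nonneg r1 hd0.le) a1.le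
      linarith
    · have hp : (0 : ℝ) < w.root 1 := by exact_mod_cast hp
      have := mul_nonneg (mul_nonneg r0 hd1.le) a0.le
      have := mul_pos (mul_pos hp hd0) a1
      linarith
  · rintro ⟨a0, a1⟩
    rcases w.root_pos with hp | hp
    · have hp : (0 : ℝ) < w.root 0 := by exact_mod_cast hp
      have := mul_neg_of_pos_of_neg (mul_pos hp hd1) a0
      have := mul_nonpos_of_nonneg_of_nonpos (mul_nonneg r1 hd0.le) a1.le
      linarith
    · have hp : (0 : ℝ) < w.root 1 := by exact_mod_cast hp
      have := mul_nonpos_of_nonneg_of_nonpos (mul_nonneg r0 hd1.le) a0.le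
      have := mul_neg_of_pos_of_neg (mul_pos hp hd0) a1
      linarith

theorem Wall.root_one_eq_zero_iff (w : Wall k d) {q : Fin 2 → ℝ} (hq : q ∈ w.carrier)
    (hq0 : q ≠ 0) : w.root 1 = 0 ↔ q 0 = 0 := by
  have h := w.rootPairing_eq_zero hq
  rw [rootPairing_toQ_eq_zero_iff hd] at h
  have hd0 : (0 : ℝ) < d 0 := by exact_mod_cast hd 0
  have hd1 : (0 : ℝ) < d 1 := by exact_mod_cast hd 1
  constructor
  · intro hr
    have hp : (0 : ℝ) < w.root 0 := by
      have := w.root_pos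
      exact_mod_cast (by omega : 0 < w.root 0)
    rw [hr] at h
    have := (mul_pos hp hd1).ne'
    simpa [this] using h
  · intro h0
    have h1 : q 1 ≠ 0 := fun h1 => hq0 (funext fun i => by fin_cases i <;> simp [h0, h1])
    rw [h0] at h
    simpa [h1, hd0.ne'] using h

end Planar

theorem IsSkewSymmetrizer.mul_eq {a b : ℤ} {d : Fin 2 → ℕ}
    (hd : IsSkewSymmetrizer !![0, b; a, 0] d) : (d 1 : ℤ) * b = -(d 0 * a) := by
  simpa using hd.skew 0 1

/-- Outgoing planar walls lie in the closed second quadrant. -/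
theorem Wall.Outgoing.notMem {k : Type*} [Field k] {a b : ℤ} (ha : a < 0) (hb : 0 < b)
    {d : Fin 2 → ℕ} (hd : IsSkewSymmetrizer !![0, b; a, 0] d) {w : Wall k d}
    (hw : w.Outgoing !![0, b; a, 0]) {q : Fin 2 → ℝ} (hq : 0 < q 0 ∨ q 1 < 0) :
    q ∉ w.carrier := by
  intro hqc
  have h := w.rootPairing_eq_zero hqc
  rw [rootPairing_toQ_eq_zero_iff hd.pos] at h
  have hd0 : (0 : ℝ) < d 0 := by exact_mod_cast hd.pos 0
  have hd1 : (0 : ℝ) < d 1 := by exact_mod_cast hd.pos 1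
  have hab : (d 1 : ℝ) * b = -(d 0 * a) := by exact_mod_cast hd.mul_eq
  have ha' : (a : ℝ) < 0 := by exact_mod_cast ha
  have hb' : (0 : ℝ) < b := by exact_mod_cast hb
  -- Both `q` and ω(·, β) are orthogonal to β, hence parallel.
  have hpar : q 0 * (a * w.root 0) = q 1 * (b * w.root 1) := by
    refine mul_left_cancel₀ (mul_pos hd0 hd1).ne' ?_
    linear_combination (a * d 0) * h - w.root 1 * d 0 * q 1 * hab
  have nn := w.neg_or_pos_of_mem hd.pos hqc
  have hr0 : (0 : ℝ) ≤ w.root 0 := Nat.cast_nonneg _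
  have hr1 : (0 : ℝ) ≤ w.root 1 := Nat.cast_nonneg _
  -- If ω(·, β) is a nonnegative multiple of `q`, then it lies in the cone, which an outgoing wall
  -- forbids.
  have hvec : ∀ r : ℝ, 0 ≤ r → r * q 0 = b * w.root 1 → r * q 1 = a * w.root 0 → False := by
    intro r hr e0 e1
    refine hw ?_
    have := w.smul_mem hqc hr
    convert this using 1
    funext i
    fin_cases i
    · simp [omegaVec, Matrix.mulVec, dotProduct, Fin.sum_univ_two, toQ, e0]
    · simp [omegaVec, Matrix.mulVec, dotProduct, Fin.sum_univ_two, toQ, e1]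
  rcases hq with h0 | h1
  · refine hvec (b * w.root 1 / q 0) (by positivity) (by field_simp) ?_
    field_simp
    linear_combination -hpar
  · refine hvec (a * w.root 0 / q 1)
      (div_nonneg_of_nonpos (mul_nonpos_of_nonpos_of_nonneg ha'.le hr0) h1.le) ?_ ?_
    · have := h1.ne
      field_simp
      linear_combination hpar
    · have := h1.ne
      field_simp

/-! ### The product of the wall functions at a point -/

section LocalFunction

variable {k : Type*} [Field k] {σ : Type*}

theorem coeff_mul_eq_of_coeff_eq_one {N : ℕ} {u : MvPowerSeries σ k}
    (hu : ∀ e : σ →₀ ℕ, e.degree ≤ N → MvPowerSeries.coeff e u = MvPowerSeries.coeff e 1)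
    (f : MvPowerSeries σ k) (e : σ →₀ ℕ) (he : e.degree ≤ N) :
    MvPowerSeries.coeff e (f * u) = MvPowerSeries.coeff e f := by
  classical
  have h : MvPowerSeries.coeff e (f * u) = MvPowerSeries.coeff e (f * 1) := by
    rw [MvPowerSeries.coeff_mul, MvPowerSeries.coeff_mul]
    refine Finset.sum_congr rfl fun x hx => ?_
    rw [hu]
    rw [← Finset.HasAntidiagonal.mem_antidiagonal.1 hx, map_add] at he
    omega
  rw [h, mul_one]

variable {n : ℕ} {d : Fin n → ℕ} {ι : Type*} (D : ScatteringDiagram k d ι)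

theorem Wall.NontrivialMod.mono {w : Wall k d} {M N : ℕ} (h : w.NontrivialMod M) (hMN : M ≤ N) :
    w.NontrivialMod N := by
  obtain ⟨e, he, h⟩ := h
  exact ⟨e, he.trans hMN, h⟩

theorem Wall.coeff_fn_of_not_nontrivialMod {w : Wall k d} {N : ℕ} (h : ¬ w.NontrivialMod N)
    {e : Fin n →₀ ℕ} (he : e.degree ≤ N) :
    MvPowerSeries.coeff e w.fn = MvPowerSeries.coeff e 1 := by
  by_contra hne
  exact h ⟨e, he, hne⟩

/-- The walls gained by raising the truncation from `e.degree` to `N` have functions equal to 1 up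
to degree `e.degree`, so they do not affect this coefficient. -/
theorem ScatteringDiagram.coeff_finprod_eq_coeff_localFn (q : Fin n → ℝ) {N : ℕ} {e : Fin n →₀ ℕ}
    (he : e.degree ≤ N) :
    MvPowerSeries.coeff e
      (∏ᶠ i ∈ {i | (D.wall i).NontrivialMod N ∧ q ∈ (D.wall i).carrier}, (D.wall i).fn) =
    MvPowerSeries.coeff e (D.localFn q) := by
  have hsub : {i | (D.wall i).NontrivialMod e.degree ∧ q ∈ (D.wall i).carrier} ⊆
      {i | (D.wall i).NontrivialMod N ∧ q ∈ (D.wall i).carrier} :=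
    fun i hi => ⟨hi.1.mono he, hi.2⟩
  rw [← finprod_mem_mul_sdiff hsub ((D.finite N).subset fun i hi => hi.1)]
  refine coeff_mul_eq_of_coeff_eq_one (N := e.degree) ?_ _ e le_rfl
  refine finprod_mem_induction (fun u => ∀ e' : Fin n →₀ ℕ, e'.degree ≤ e.degree →
    MvPowerSeries.coeff e' u = MvPowerSeries.coeff e' 1) (fun _ _ => rfl) ?_ ?_
  · intro x y hx hy e' he'
    rw [coeff_mul_eq_of_coeff_eq_one hy x e' he', hx e' he']
  · intro i hi e' he'
    exact Wall.coeff_fn_of_not_nontrivialMod (fun h => hi.2 ⟨h, hi.1.2⟩) he'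

theorem ScatteringDiagram.localFn_eq_one {q : Fin n → ℝ} (h : ∀ i, q ∉ (D.wall i).carrier) :
    D.localFn q = 1 := by
  ext e
  have : {i | (D.wall i).NontrivialMod e.degree ∧ q ∈ (D.wall i).carrier} = ∅ := by
    ext i
    simp [h i]
  rw [← D.coeff_finprod_eq_coeff_localFn q le_rfl, this, finprod_mem_empty]

theorem ScatteringDiagram.localFn_eq_fn {q : Fin n → ℝ} {j : ι}
    (h : ∀ i, q ∈ (D.wall i).carrier ↔ i = j) : D.localFn q = (D.wall j).fn := by
  ext e
  by_cases hj : (D.wall j).NontrivialMod e.degree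
  · have : {i | (D.wall i).NontrivialMod e.degree ∧ q ∈ (D.wall i).carrier} = {j} := by
      ext i
      simp only [h, Set.mem_ofPred_eq, Set.mem_singleton_iff, and_iff_right_iff_imp]
      rintro rfl
      exact hj
    rw [← D.coeff_finprod_eq_coeff_localFn q le_rfl, this, finprod_mem_singleton]
  · have : {i | (D.wall i).NontrivialMod e.degree ∧ q ∈ (D.wall i).carrier} = ∅ := by
      ext i
      simp only [h, Set.mem_ofPred_eq, Set.mem_empty_iff_false, iff_false, not_and]
      rintro h1 rfl
      exact hj h1
    rw [← D.coeff_finprod_eq_coeff_localFn q le_rfl, this, finprod_mem_empty,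
      Wall.coeff_fn_of_not_nontrivialMod hj le_rfl]

end LocalFunction

/-! ### Wall functions modulo ŷ_1 -/

section Divisibility

variable {k : Type*} [Field k] {d : Fin 2 → ℕ}

theorem dvd_mul_sub_one {R : Type*} [CommRing R] {x a b : R} (ha : x ∣ a - 1) (hb : x ∣ b - 1) :
    x ∣ a * b - 1 := by
  have : a * b - 1 = (a - 1) * b + (b - 1) := by ring
  exact this ▸ dvd_add (ha.mul_right b) hb

/-- The function is a series in ŷ^β with β_1 ≠ 0, so every nonconstant term contains ŷ_1. -/
theorem Wall.X_dvd_fn_sub_one (w : Wall k d) (h : w.root 1 ≠ 0) :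
    (MvPowerSeries.X 1 : MvPowerSeries (Fin 2) k) ∣ w.fn - 1 := by
  rw [MvPowerSeries.X_dvd_iff]
  intro e he
  rw [map_sub, sub_eq_zero]
  by_cases he0 : e = 0
  · subst he0
    simpa using w.fn_constantCoeff
  · rw [MvPowerSeries.coeff_one, if_neg he0]
    by_contra hne
    obtain ⟨m, hm⟩ := w.fn_support e hne
    have hm0 : m = 0 := by
      have := hm 1
      rw [he] at this
      simpa [h] using this.symm
    exact he0 (Finsupp.ext fun i => by simp [hm, hm0])

variable {ι : Type*} (D : ScatteringDiagram k d ι)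

theorem ScatteringDiagram.X_dvd_localFn_sub_one {q : Fin 2 → ℝ}
    (h : ∀ i, q ∈ (D.wall i).carrier → (D.wall i).root 1 ≠ 0) :
    (MvPowerSeries.X 1 : MvPowerSeries (Fin 2) k) ∣ D.localFn q - 1 := by
  rw [MvPowerSeries.X_dvd_iff]
  intro e he
  rw [map_sub, ← D.coeff_finprod_eq_coeff_localFn q le_rfl, ← map_sub]
  refine MvPowerSeries.X_dvd_iff.1 ?_ e he
  refine finprod_mem_induction (fun u => (MvPowerSeries.X 1 : MvPowerSeries (Fin 2) k) ∣ u - 1)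
    (by simp) (fun x y => dvd_mul_sub_one) fun i hi => (D.wall i).X_dvd_fn_sub_one (h i hi.2)

theorem ScatteringDiagram.coeff_localFn_eq_zero {q : Fin 2 → ℝ}
    (h : ∀ i, q ∈ (D.wall i).carrier → (D.wall i).root 1 = 0) {e : Fin 2 →₀ ℕ} (he : e 1 ≠ 0) :
    MvPowerSeries.coeff e (D.localFn q) = 0 := by
  rw [← D.coeff_finprod_eq_coeff_localFn q le_rfl]
  refine finprod_mem_induction (fun u => ∀ e : Fin 2 →₀ ℕ, e 1 ≠ 0 →
    MvPowerSeries.coeff e u = 0) ?_ ?_ ?_ e he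
  · intro e he
    rw [MvPowerSeries.coeff_one, if_neg]
    rintro rfl
    exact he rfl
  · intro x y hx hy e he
    rw [MvPowerSeries.coeff_mul]
    refine Finset.sum_eq_zero fun p hp => ?_
    rw [← Finset.HasAntidiagonal.mem_antidiagonal.1 hp, Finsupp.add_apply] at he
    by_cases h1 : p.1 1 = 0
    · rw [hy p.2 (by omega), mul_zero]
    · rw [hx p.1 h1, zero_mul]
  · intro i hi e he
    by_contra hne
    obtain ⟨m, hm⟩ := (D.wall i).fn_support e hne
    exact he (by rw [hm 1, h i hi.2, mul_zero])

end Divisibility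

/-! ### Wall-crossing automorphisms modulo ŷ_1 -/

section Crossing

variable {k : Type*} [Field k]

/-- Divisibility by a variable is tested on the coefficients free of it. Each such coefficient of a
substituted series is a sum over monomials, and the substituted monomials agree in the quotient by
that variable. -/
theorem X_dvd_subst_sub_subst {σ τ : Type*} {a a' : σ → MvPowerSeries τ k}
    (ha : MvPowerSeries.HasSubst a) (ha' : MvPowerSeries.HasSubst a') (t : τ)
    (h : ∀ s, MvPowerSeries.X t ∣ a s - a' s) (g : MvPowerSeries σ k) :
    MvPowerSeries.X t ∣ MvPowerSeries.subst a g - MvPowerSeries.subst a' g := by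
  rw [MvPowerSeries.X_dvd_iff]
  intro e he
  rw [map_sub, MvPowerSeries.coeff_subst ha, MvPowerSeries.coeff_subst ha', sub_eq_zero]
  refine finsum_congr fun c => ?_
  congr 1
  rw [← sub_eq_zero, ← map_sub]
  refine MvPowerSeries.X_dvd_iff.1 ?_ e he
  rw [← Ideal.mem_span_singleton, ← Ideal.Quotient.eq, Finsupp.prod, Finsupp.prod, map_prod,
    map_prod]
  refine Finset.prod_congr rfl fun s _ => ?_
  rw [map_pow, map_pow]
  congr 1
  rw [Ideal.Quotient.eq, Ideal.mem_span_singleton]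
  exact h s

theorem dvd_zpowSeries_sub_one {σ : Type*} {f x : MvPowerSeries σ k}
    (hf : MvPowerSeries.constantCoeff f = 1) (h : x ∣ f - 1) (m : ℤ) :
    x ∣ zpowSeries f m - 1 := by
  have key : ∀ (u : MvPowerSeries σ k) (n : ℕ), x ∣ u - 1 → x ∣ u ^ n - 1 := fun u n hu =>
    hu.trans (by simpa using sub_dvd_pow_sub_pow u 1 n)
  unfold zpowSeries
  split_ifs
  · exact key _ _ h
  · refine key _ _ ?_
    have : f⁻¹ - 1 = -(f⁻¹ * (f - 1)) := by
      rw [mul_sub, MvPowerSeries.inv_mul_cancel f (by simp [hf])]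
      ring
    exact this ▸ (h.mul_left _).neg_right

theorem Wall.hasSubst_crossing {n : ℕ} {d : Fin n → ℕ} (B : Matrix (Fin n) (Fin n) ℤ)
    (w : Wall k d) (s : ℤ) : MvPowerSeries.HasSubst
    (Sum.elim
      (fun i => MvPowerSeries.X (Sum.inl i) *
        zpowSeries (MvPowerSeries.rename Sum.inr w.fn) (s * coroot d w.root i))
      (fun j => MvPowerSeries.X (Sum.inr j) *
        zpowSeries (MvPowerSeries.rename Sum.inr w.fn) (s * Matrix.vecMul (coroot d w.root) B j)) :
      Fin n ⊕ Fin n → XYSeries k n) := by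
  refine MvPowerSeries.hasSubst_of_constantCoeff_zero fun i => ?_
  rcases i with i | i <;> simp

variable {d : Fin 2 → ℕ}

theorem Wall.X_dvd_crossing_sub_self (B : Matrix (Fin 2) (Fin 2) ℤ) (w : Wall k d)
    (h : w.root 1 ≠ 0) (s : ℤ) (g : XYSeries k 2) :
    MvPowerSeries.X (Sum.inr 1) ∣ w.crossing B s g - g := by
  have hf : (MvPowerSeries.X (Sum.inr 1) : XYSeries k 2) ∣
      MvPowerSeries.rename Sum.inr w.fn - 1 := by
    have := map_dvd (MvPowerSeries.rename (R := k) (Sum.inr : Fin 2 → Fin 2 ⊕ Fin 2))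
      (w.X_dvd_fn_sub_one h)
    simpa using this
  have hc : MvPowerSeries.constantCoeff (MvPowerSeries.rename (Sum.inr : Fin 2 → Fin 2 ⊕ Fin 2)
      w.fn) = 1 := by
    rw [MvPowerSeries.constantCoeff_rename, w.fn_constantCoeff]
  have := X_dvd_subst_sub_subst (w.hasSubst_crossing B s) MvPowerSeries.HasSubst.X (Sum.inr 1)
    (fun i => ?_) g
  · change _ ∣ _ - MvPowerSeries.subst MvPowerSeries.X g at this
    rwa [MvPowerSeries.subst_self] at this
  · rcases i with i | i
    · rw [Sum.elim_inl, ← mul_sub_one]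
      exact (dvd_zpowSeries_sub_one hc hf _).mul_left _
    · rw [Sum.elim_inr, ← mul_sub_one]
      exact (dvd_zpowSeries_sub_one hc hf _).mul_left _

theorem Wall.X_dvd_crossing (B : Matrix (Fin 2) (Fin 2) ℤ) (w : Wall k d) (s : ℤ)
    {g : XYSeries k 2} (hg : MvPowerSeries.X (Sum.inr 1) ∣ g) :
    MvPowerSeries.X (Sum.inr 1) ∣ w.crossing B s g := by
  obtain ⟨g, rfl⟩ := hg
  rw [Wall.crossing, MvPowerSeries.subst_mul (w.hasSubst_crossing B s),
    MvPowerSeries.subst_X (w.hasSubst_crossing B s), Sum.elim_inr]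
  exact Dvd.dvd.mul_right (dvd_mul_right _ _) _

theorem Wall.crossing_sub (B : Matrix (Fin 2) (Fin 2) ℤ) (w : Wall k d) (s : ℤ)
    (g h : XYSeries k 2) : w.crossing B s (g - h) = w.crossing B s g - w.crossing B s h := by
  rw [Wall.crossing, MvPowerSeries.subst_sub (w.hasSubst_crossing B s)]
  rfl

theorem coroot_single_zero (hd : ∀ i, 0 < d i) : coroot d (Pi.single 0 1) = Pi.single 0 1 := by
  have h : Finset.univ.gcd (fun l : Fin 2 => (Pi.single 0 1 : Fin 2 → ℕ) l *
      ∏ j ∈ Finset.univ.erase l, d j) = d 1 := by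
    rw [show (Finset.univ : Finset (Fin 2)) = {0, 1} from rfl, Finset.gcd_insert,
      Finset.gcd_singleton]
    have : ({0, 1} : Finset (Fin 2)).erase 0 = {1} := by decide
    simp [this]
  funext i
  rw [coroot, h]
  fin_cases i
  · have : (Finset.univ : Finset (Fin 2)).erase 0 = {1} := by decide
    simp [this, Nat.div_self (hd 1)]
  · simp

/-- Here the root is α_0. Since ω(α_0^∨, α_0) = 0, the crossing fixes ŷ_0; it multiplies x_0 by the
wall function and sends ŷ_1 to a multiple of itself, so modulo ŷ_1 it is multiplication by the wall
function. -/
theorem Wall.X_dvd_crossing_X_mul_sub (hd : ∀ i, 0 < d i) (a b : ℤ) (w : Wall k d)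
    (h : w.root 1 = 0) (G : MvPowerSeries (Fin 2) k) :
    MvPowerSeries.X (Sum.inr 1) ∣
      w.crossing !![0, b; a, 0] 1 (MvPowerSeries.X (Sum.inl 0) * MvPowerSeries.rename Sum.inr G) -
        MvPowerSeries.X (Sum.inl 0) * MvPowerSeries.rename Sum.inr (G * w.fn) := by
  have hs := w.hasSubst_crossing !![0, b; a, 0] 1
  rw [Wall.crossing, MvPowerSeries.subst_mul hs, MvPowerSeries.subst_X hs,
    MvPowerSeries.rename_eq_subst (p := G),
    MvPowerSeries.subst_comp_subst_apply (MvPowerSeries.HasSubst.X_comp _) hs, map_mul]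
  have hG := X_dvd_subst_sub_subst (MvPowerSeries.HasSubst.comp
    (MvPowerSeries.HasSubst.X_comp (R := k) (Sum.inr : Fin 2 → Fin 2 ⊕ Fin 2)) hs)
    (MvPowerSeries.HasSubst.X_comp (R := k) Sum.inr) (Sum.inr 1) (fun i => ?_) G
  · rw [MvPowerSeries.rename_eq_subst (p := G)]
    simp only [MvPowerSeries.substAlgHom_apply] at hG
    have h1 : zpowSeries (MvPowerSeries.rename (Sum.inr : Fin 2 → Fin 2 ⊕ Fin 2) w.fn)
        (1 * coroot d w.root 0) = MvPowerSeries.rename Sum.inr w.fn := by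
      simp [zpowSeries, w.root_eq_of_one_eq_zero h, coroot_single_zero hd]
    rw [Sum.elim_inl, h1]
    refine (hG.mul_left (MvPowerSeries.X (Sum.inl 0) * MvPowerSeries.rename Sum.inr w.fn)).trans
      (dvd_of_eq ?_)
    ring
  · simp only [Function.comp]
    rw [MvPowerSeries.substAlgHom_apply, MvPowerSeries.subst_X hs, Sum.elim_inr, w.root_eq_of_one_eq_zero h,
      coroot_single_zero hd]
    fin_cases i
    · simp [zpowSeries]
    · exact dvd_sub (dvd_mul_right _ _) dvd_rfl

variable {ι : Type*} (D : ScatteringDiagram k d ι)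

-- Modulo ŷ_1 only the walls with root α_0 act, each by multiplication, so the noncommutative
-- path-ordered product collapses to an ordinary product of series.
open Classical in
theorem X_dvd_crossingProduct_sub (hd : ∀ i, 0 < d i) (a b : ℤ) (γ : ℝ → Fin 2 → ℝ)
    (l : List (ι × ℝ)) (hl : ∀ c ∈ l, crossingSign d γ c.2 (D.wall c.1).root = 1)
    (g : XYSeries k 2) (G : MvPowerSeries (Fin 2) k)
    (h : MvPowerSeries.X (Sum.inr 1) ∣
      g - MvPowerSeries.X (Sum.inl 0) * MvPowerSeries.rename Sum.inr G) :
    MvPowerSeries.X (Sum.inr 1) ∣ crossingProduct !![0, b; a, 0] D γ l g -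
      MvPowerSeries.X (Sum.inl 0) * MvPowerSeries.rename Sum.inr
        (G * (l.map fun c => if (D.wall c.1).root 1 = 0 then (D.wall c.1).fn else 1).prod) := by
  induction l generalizing g G with
  | nil => simpa [crossingProduct] using h
  | cons c l ih =>
    have hstep : MvPowerSeries.X (Sum.inr 1) ∣ (D.wall c.1).crossing !![0, b; a, 0] 1 g -
        MvPowerSeries.X (Sum.inl 0) * MvPowerSeries.rename Sum.inr
          (G * if (D.wall c.1).root 1 = 0 then (D.wall c.1).fn else 1) := by
      by_cases hr : (D.wall c.1).root 1 = 0
      · rw [if_pos hr]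
        have h1 := (D.wall c.1).X_dvd_crossing !![0, b; a, 0] 1 h
        rw [Wall.crossing_sub] at h1
        simpa using dvd_add h1 ((D.wall c.1).X_dvd_crossing_X_mul_sub hd a b hr G)
      · rw [if_neg hr, mul_one]
        simpa using dvd_add ((D.wall c.1).X_dvd_crossing_sub_self !![0, b; a, 0] hr 1 g) h
    have := ih (fun c hc => hl c (List.mem_cons_of_mem _ hc)) _ _ hstep
    rw [crossingProduct, List.foldl_cons, hl c List.mem_cons_self, List.map_cons, List.prod_cons,
      ← mul_assoc]
    exact this

theorem coeff_X_mul_rename (P : MvPowerSeries (Fin 2) k) (e : Fin 2 →₀ ℕ) :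
    MvPowerSeries.coeff (Finsupp.single (Sum.inl 0) 1 +
      Finsupp.embDomain ⟨Sum.inr, Sum.inr_injective⟩ e : Fin 2 ⊕ Fin 2 →₀ ℕ)
      (MvPowerSeries.X (Sum.inl 0) * MvPowerSeries.rename Sum.inr P) = MvPowerSeries.coeff e P := by
  rw [MvPowerSeries.X, MvPowerSeries.coeff_add_monomial_mul, one_mul]
  exact MvPowerSeries.coeff_embDomain_rename _ P e

end Crossing

/-- A path from `(1, 1)` to `(-1, -1)`; both coordinates decrease if `|c| < 2`. -/
def arcPath (c : ℝ) (t : ℝ) : Fin 2 → ℝ :=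
  ![1 - 2 * t - c * (t * (1 - t)), 1 - 2 * t + c * (t * (1 - t))]

theorem hasDerivAt_arcPath (c t : ℝ) :
    HasDerivAt (arcPath c) ![-2 - c * (1 - 2 * t), -2 + c * (1 - 2 * t)] t := by
  have h1 : HasDerivAt (fun t : ℝ => 1 - 2 * t) (-2) t := by
    simpa using ((hasDerivAt_id t).const_mul 2).const_sub 1
  have h2 : HasDerivAt (fun t : ℝ => c * (t * (1 - t))) (c * (1 - 2 * t)) t := by
    have := ((hasDerivAt_id t).mul ((hasDerivAt_id t).const_sub 1)).const_mul c
    refine this.congr_deriv ?_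
    change c * (1 * (1 - t) + t * -1) = _
    ring
  rw [hasDerivAt_pi]
  intro i
  fin_cases i
  · exact h1.sub h2
  · exact h1.add h2

theorem arcPath_ne_zero {c : ℝ} (hc : c ≠ 0) (t : ℝ) : arcPath c t ≠ 0 := by
  intro h
  have h0 : 1 - 2 * t - c * (t * (1 - t)) = 0 := congrFun h 0
  have h1 : 1 - 2 * t + c * (t * (1 - t)) = 0 := congrFun h 1
  have ht : t = 1 / 2 := by linarith
  subst ht
  exact hc (by linarith)

theorem arcPath_strictAnti {c : ℝ} (hc : |c| < 2) {t t' : ℝ} (ht : 0 ≤ t) (htt : t < t')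
    (ht' : t' ≤ 1) (i : Fin 2) : arcPath c t' i < arcPath c t i := by
  rw [abs_lt] at hc
  have h : 0 < t' - t := by linarith
  -- The coordinates drop by (t' - t)(2 ± c (1 - t - t')).
  have h1 : 0 < 2 + c * (1 - t - t') := by nlinarith
  have h2 : 0 < 2 - c * (1 - t - t') := by nlinarith
  fin_cases i
  · change 1 - 2 * t' - c * (t' * (1 - t')) < 1 - 2 * t - c * (t * (1 - t))
    nlinarith [mul_pos h h1]
  · change 1 - 2 * t' + c * (t' * (1 - t')) < 1 - 2 * t + c * (t * (1 - t))
    nlinarith [mul_pos h h2]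

/-! ### Consistency along two arcs around the origin -/

section Consistency

variable {k : Type*} [Field k] {d : Fin 2 → ℕ} (hd : ∀ i, 0 < d i)
include hd

theorem rootPairing_neg {x : Fin 2 → ℝ} (hx : ∀ i, x i < 0) (w : Wall k d) :
    rootPairing d x (toQ w.root) < 0 := by
  have hd0 : (0 : ℝ) < d 0 := by exact_mod_cast hd 0
  have hd1 : (0 : ℝ) < d 1 := by exact_mod_cast hd 1
  rw [rootPairing_fin_two]
  simp only [toQ, Int.cast_natCast]
  have n0 := div_neg_of_neg_of_pos (hx 0) hd0
  have n1 := div_neg_of_neg_of_pos (hx 1) hd1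
  rcases w.root_pos with h | h
  · have h : (0 : ℝ) < w.root 0 := by exact_mod_cast h
    exact add_neg_of_neg_of_nonpos (mul_neg_of_pos_of_neg h n0)
      (mul_nonpos_of_nonneg_of_nonpos (Nat.cast_nonneg _) n1.le)
  · have h : (0 : ℝ) < w.root 1 := by exact_mod_cast h
    exact add_neg_of_nonpos_of_neg
      (mul_nonpos_of_nonneg_of_nonpos (Nat.cast_nonneg _) n0.le) (mul_neg_of_pos_of_neg h n1)

theorem rootPairing_deriv_arcPath {c : ℝ} (hc : |c| < 2) {t : ℝ} (ht : t ∈ Set.Icc (0 : ℝ) 1)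
    (w : Wall k d) :
    rootPairing d ![-2 - c * (1 - 2 * t), -2 + c * (1 - 2 * t)] (toQ w.root) < 0 := by
  refine rootPairing_neg hd (fun i => ?_) w
  have h : |c * (1 - 2 * t)| < 2 := by
    have : |1 - 2 * t| ≤ 1 := abs_le.2 ⟨by linarith [ht.2], by linarith [ht.1]⟩
    rw [abs_mul]
    nlinarith [abs_nonneg c]
  rw [abs_lt] at h
  fin_cases i
  · change -2 - c * (1 - 2 * t) < 0
    linarith
  · change -2 + c * (1 - 2 * t) < 0
    linarith

theorem crossingSign_arcPath {c : ℝ} (hc : |c| < 2) {t : ℝ} (ht : t ∈ Set.Icc (0 : ℝ) 1)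
    (w : Wall k d) : crossingSign d (arcPath c) t w.root = 1 := by
  rw [crossingSign, if_pos]
  rw [(hasDerivAt_arcPath c t).hasDerivWithinAt.derivWithin (uniqueDiffWithinAt_Ici t)]
  exact rootPairing_deriv_arcPath hd hc ht w

/-- Both coordinates decrease along the arc, hence so does the pairing with any root: each wall is
crossed at most once. -/
theorem arcPath_time_unique {c : ℝ} (hc : |c| < 2) {t t' : ℝ} (ht : t ∈ Set.Icc (0 : ℝ) 1)
    (ht' : t' ∈ Set.Icc (0 : ℝ) 1) (w : Wall k d) (h : arcPath c t ∈ w.carrier)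
    (h' : arcPath c t' ∈ w.carrier) : t = t' := by
  have key : ∀ {t t' : ℝ}, 0 ≤ t → t' ≤ 1 → arcPath c t ∈ w.carrier →
      arcPath c t' ∈ w.carrier → ¬ t < t' := by
    intro t t' h0 h1 h h' htt
    have := rootPairing_neg hd (x := arcPath c t' + (-1 : ℝ) • arcPath c t) (fun i => by
      have := arcPath_strictAnti hc h0 htt h1 i
      simp only [Pi.add_apply, Pi.smul_apply, smul_eq_mul]
      linarith) w
    rw [rootPairing_add, rootPairing_smul, w.rootPairing_eq_zero h, w.rootPairing_eq_zero h'] at this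
    simp at this
  exact le_antisymm (not_lt.1 (key ht'.1 ht.2 h' h)) (not_lt.1 (key ht.1 ht'.2 h h'))

variable {ι : Type*} (D : ScatteringDiagram k d ι)

theorem isGenericPath_arcPath {c : ℝ} (hc : |c| < 2) (hc0 : c ≠ 0) :
    IsGenericPath D (arcPath c) where
  piecewise :=
    { continuousOn := fun t _ => (hasDerivAt_arcPath c t).continuousAt.continuousWithinAt
      right := fun t _ => (hasDerivAt_arcPath c t).differentiableAt.differentiableWithinAt
      left := fun t _ => (hasDerivAt_arcPath c t).differentiableAt.differentiableWithinAt
      finite := by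
        convert Set.finite_empty (α := ℝ)
        refine Set.eq_empty_of_forall_notMem fun t ht => ?_
        exact ht.2 (hasDerivAt_arcPath c t).differentiableAt }
  avoids_intersections := fun i j hij t _ ht =>
    arcPath_ne_zero hc0 t (Wall.eq_zero_of_mem_inter hd _ _ hij ht)
  avoids_boundaries := fun i t _ ht =>
    arcPath_ne_zero hc0 t (Wall.intrinsicFrontier_subset hd _ ht)
  start_notMem := fun i h => (Wall.neg_or_pos_of_mem hd _ h).1 (by simp [arcPath])
  end_notMem := fun i h => (Wall.neg_or_pos_of_mem hd _ h).2 (by norm_num [arcPath])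
  transverse := fun i t ht _ => by
    rw [(hasDerivAt_arcPath c t).hasDerivWithinAt.derivWithin (uniqueDiffWithinAt_Ici t),
      (hasDerivAt_arcPath c t).hasDerivWithinAt.derivWithin (uniqueDiffWithinAt_Iic t)]
    exact mul_pos_of_neg_of_neg (rootPairing_deriv_arcPath hd hc (Set.Ioo_subset_Icc_self ht) _)
      (rootPairing_deriv_arcPath hd hc (Set.Ioo_subset_Icc_self ht) _)

/-- The condition defining a path-ordered product quantifies over crossing lists, so it yields
information only once such a list is exhibited. -/
theorem exists_isCrossingList_arcPath {c : ℝ} (hc : |c| < 2) (N : ℕ) :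
    ∃ l, IsCrossingList D (arcPath c) N l := by
  classical
  have hfin : {x : ι × ℝ | (D.wall x.1).NontrivialMod N ∧ x.2 ∈ Set.Icc (0 : ℝ) 1 ∧
      arcPath c x.2 ∈ (D.wall x.1).carrier}.Finite := by
    refine Set.Finite.of_finite_image ((D.finite N).subset ?_) (f := Prod.fst) ?_
    · rintro _ ⟨x, hx, rfl⟩
      exact hx.1
    · rintro ⟨i, t⟩ hx ⟨j, t'⟩ hy hij
      obtain rfl : i = j := hij
      exact congrArg _ (arcPath_time_unique hd hc hx.2.1 hy.2.1 _ hx.2.2 hy.2.2)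
  let r : ι × ℝ → ι × ℝ → Prop := fun x y => x.2 ≤ y.2
  have : Std.Total r := ⟨fun x y => le_total x.2 y.2⟩
  have : IsTrans _ r := ⟨fun x y z => le_trans (a := x.2)⟩
  refine ⟨hfin.toFinset.toList.insertionSort r, ?_, fun i t => ?_, ?_⟩
  · exact (List.perm_insertionSort r _).nodup_iff.2 (Finset.nodup_toList _)
  · rw [(List.perm_insertionSort r _).mem_iff, Finset.mem_toList, Set.Finite.mem_toFinset]
    rfl
  · exact List.pairwise_insertionSort r _

-- The walls with root α_0 lie on q_0 = 0, which the arc meets only at time `t₀`; the crossings that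
-- survive modulo ŷ_1 are therefore the walls through that one point.
open Classical in
theorem prod_crossingList {c : ℝ} (hc : |c| < 2) (hc0 : c ≠ 0) {t₀ : ℝ}
    (ht₀ : t₀ ∈ Set.Icc (0 : ℝ) 1) (h₀ : arcPath c t₀ 0 = 0) {N : ℕ} {l : List (ι × ℝ)}
    (hl : IsCrossingList D (arcPath c) N l) :
    (l.map fun c => if (D.wall c.1).root 1 = 0 then (D.wall c.1).fn else 1).prod =
      ∏ᶠ i ∈ {i | (D.wall i).NontrivialMod N ∧ arcPath c t₀ ∈ (D.wall i).carrier},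
        (D.wall i).fn := by
  have hfin : {i | (D.wall i).NontrivialMod N ∧ arcPath c t₀ ∈ (D.wall i).carrier}.Finite :=
    (D.finite N).subset fun i hi => hi.1
  rw [← List.prod_toFinset _ hl.nodup, finprod_mem_eq_finite_toFinset_prod _ hfin,
    ← Finset.prod_filter]
  refine Finset.prod_nbij' (fun x => x.1) (fun i => (i, t₀)) ?_ ?_ ?_ ?_ ?_
  all_goals
    simp only [Finset.mem_filter, List.mem_toFinset, Set.Finite.mem_toFinset]
  · rintro ⟨i, t⟩ ⟨hx, hr⟩
    obtain ⟨hN, ht, hm⟩ := (hl.mem_iff i t).1 hx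
    have h0 := (Wall.root_one_eq_zero_iff hd _ hm (arcPath_ne_zero hc0 t)).1 hr
    obtain rfl : t = t₀ := by
      rcases lt_trichotomy t t₀ with h | h | h
      · have := arcPath_strictAnti hc ht.1 h ht₀.2 0
        rw [h0, h₀] at this
        exact absurd this (lt_irrefl _)
      · exact h
      · have := arcPath_strictAnti hc ht₀.1 h ht.2 0
        rw [h0, h₀] at this
        exact absurd this (lt_irrefl _)
    exact ⟨hN, hm⟩
  · rintro i ⟨hN, hm⟩
    exact ⟨(hl.mem_iff i t₀).2 ⟨hN, ht₀, hm⟩,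
      (Wall.root_one_eq_zero_iff hd _ hm (arcPath_ne_zero hc0 t₀)).2 h₀⟩
  · rintro ⟨i, t⟩ ⟨hx, hr⟩
    obtain ⟨hN, ht, hm⟩ := (hl.mem_iff i t).1 hx
    have h0 := (Wall.root_one_eq_zero_iff hd _ hm (arcPath_ne_zero hc0 t)).1 hr
    rcases lt_trichotomy t t₀ with h | h | h
    · have := arcPath_strictAnti hc ht.1 h ht₀.2 0
      rw [h0, h₀] at this
      exact absurd this (lt_irrefl _)
    · rw [h]
    · have := arcPath_strictAnti hc ht₀.1 h ht.2 0
      rw [h0, h₀] at this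
      exact absurd this (lt_irrefl _)
  · intro i _
    trivial
  · intro x _
    trivial

theorem coeff_crossingProduct_arcPath (a b : ℤ) {c : ℝ} (hc : |c| < 2) (hc0 : c ≠ 0) {t₀ : ℝ}
    (ht₀ : t₀ ∈ Set.Icc (0 : ℝ) 1) (h₀ : arcPath c t₀ 0 = 0) {N : ℕ} {l : List (ι × ℝ)}
    (hl : IsCrossingList D (arcPath c) N l) {e : Fin 2 →₀ ℕ} (he : e.degree ≤ N) (he1 : e 1 = 0) :
    MvPowerSeries.coeff (Finsupp.single (Sum.inl 0) 1 +
      Finsupp.embDomain ⟨Sum.inr, Sum.inr_injective⟩ e : Fin 2 ⊕ Fin 2 →₀ ℕ)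
      (crossingProduct !![0, b; a, 0] D (arcPath c) l (MvPowerSeries.X (Sum.inl 0))) =
    MvPowerSeries.coeff e (D.localFn (arcPath c t₀)) := by
  classical
  have h := X_dvd_crossingProduct_sub D hd a b (arcPath c) l
    (fun x hx => crossingSign_arcPath hd hc ((hl.mem_iff x.1 x.2).1 hx).2.1 _)
    (MvPowerSeries.X (Sum.inl 0)) 1 (by simp)
  rw [one_mul, prod_crossingList hd D hc hc0 ht₀ h₀ hl] at h
  rw [← D.coeff_finprod_eq_coeff_localFn _ he, ← coeff_X_mul_rename, ← sub_eq_zero, ← map_sub]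
  refine MvPowerSeries.X_dvd_iff.1 h _ ?_
  rw [Finsupp.add_apply]
  have := Finsupp.embDomain_apply_self (⟨Sum.inr, Sum.inr_injective⟩ : Fin 2 ↪ Fin 2 ⊕ Fin 2) e 1
  rw [he1] at this
  simpa using this

/-- The two arcs share their endpoints but meet the axis q_0 = 0 on opposite sides of the origin.
Comparing the coefficients of x_0 ŷ^e with e_1 = 0 in the images of x_0 compares the two local
products. -/
theorem ScatteringDiagram.Consistent.coeff_localFn_eq {a b : ℤ}
    (hD : D.Consistent !![0, b; a, 0]) {e : Fin 2 →₀ ℕ} (he1 : e 1 = 0) :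
    MvPowerSeries.coeff e (D.localFn ![0, 2 / 3]) =
      MvPowerSeries.coeff e (D.localFn ![0, -(2 / 3)]) := by
  -- The value 3/2 makes the crossing times 1/3 and 2/3 rational.
  have hc : |(3 / 2 : ℝ)| < 2 := by rw [abs_lt]; norm_num
  have hc' : |(-(3 / 2) : ℝ)| < 2 := by rw [abs_lt]; norm_num
  have e1 : arcPath (3 / 2) (1 / 3) = ![0, 2 / 3] := by
    funext i
    fin_cases i <;> norm_num [arcPath]
  have e2 : arcPath (-(3 / 2)) (2 / 3) = ![0, -(2 / 3)] := by
    funext i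
    fin_cases i <;> norm_num [arcPath]
  obtain ⟨F, hF, hF'⟩ := hD _ _ (isGenericPath_arcPath hd D hc (by norm_num))
    (isGenericPath_arcPath hd D hc' (by norm_num)) (by simp [arcPath]) (by norm_num [arcPath])
  have hN := ((hF (MvPowerSeries.X (Sum.inl 0)) (Finsupp.single (Sum.inl 0) 1 +
    Finsupp.embDomain ⟨Sum.inr, Sum.inr_injective⟩ e)).and
    (hF' (MvPowerSeries.X (Sum.inl 0)) (Finsupp.single (Sum.inl 0) 1 +
    Finsupp.embDomain ⟨Sum.inr, Sum.inr_injective⟩ e))).and (eventually_ge_atTop e.degree)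
  obtain ⟨N, ⟨h1, h2⟩, hN⟩ := hN.exists
  obtain ⟨l, hl⟩ := exists_isCrossingList_arcPath hd D hc N
  obtain ⟨l', hl'⟩ := exists_isCrossingList_arcPath hd D hc' N
  have h1 := h1 l hl
  have h2 := h2 l' hl'
  rw [coeff_crossingProduct_arcPath hd D a b hc (by norm_num) (t₀ := 1 / 3) (by norm_num)
    (by rw [e1]; rfl) hl hN he1, e1] at h1
  rw [coeff_crossingProduct_arcPath hd D a b hc' (by norm_num) (t₀ := 2 / 3) (by norm_num)
    (by rw [e2]; rfl) hl' hN he1, e2] at h2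
  rw [h1, h2]

end Consistency

/-! ### Local functions of the cluster scattering diagram -/

section LocalFunctions

variable {k : Type*} [Field k] {a b : ℤ} (ha : a < 0) (hb : 0 < b)
  {d : Fin 2 → ℕ} (hd : IsSkewSymmetrizer !![0, b; a, 0] d) {ι : Type*}
  {D : ScatteringDiagram k d ι} (hD : IsTransposedClusterScattering !![0, b; a, 0] D)

theorem ScatteringDiagram.localFn_smul (D : ScatteringDiagram k d ι) (q : Fin 2 → ℝ) {r : ℝ}
    (hr : 0 < r) : D.localFn (r • q) = D.localFn q := by
  have h : ∀ i, r • q ∈ (D.wall i).carrier ↔ q ∈ (D.wall i).carrier := by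
    refine fun i => ⟨fun h => ?_, fun h => (D.wall i).smul_mem h hr.le⟩
    have := (D.wall i).smul_mem h (inv_nonneg.2 hr.le)
    rwa [smul_smul, inv_mul_cancel₀ hr.ne', one_smul] at this
  funext e
  simp only [ScatteringDiagram.localFn, h]

include hd

theorem mem_hyperplane_single_iff (q : Fin 2 → ℝ) (i : Fin 2) :
    q ∈ hyperplane d (Pi.single i 1) ↔ q i = 0 := by
  have h0 : (d 0 : ℝ) ≠ 0 := by exact_mod_cast (hd.pos 0).ne'
  have h1 : (d 1 : ℝ) ≠ 0 := by exact_mod_cast (hd.pos 1).ne'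
  rw [hyperplane, Set.mem_ofPred_eq, rootPairing_toQ_eq_zero_iff hd.pos]
  fin_cases i <;> simp [h0, h1]

include hD

/-- Every hyperplane `α_i^⊥` is the carrier of a wall. -/
theorem exists_wall_of_coord_eq_zero (i : Fin 2) :
    ∃ j, ∀ q : Fin 2 → ℝ, q ∈ (D.wall j).carrier ↔ q i = 0 := by
  obtain ⟨ini, hini, -⟩ := hD.initial
  exact ⟨ini i, fun q => by rw [(hini i).2.1, mem_hyperplane_single_iff hd]⟩

include ha hb

theorem exists_initial_wall (i : Fin 2) : ∃ j, (D.wall j).fn = 1 + MvPowerSeries.X i ∧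
    ∀ q : Fin 2 → ℝ, (0 < q 0 ∨ q 1 < 0) → q i = 0 → ∀ l, q ∈ (D.wall l).carrier ↔ l = j := by
  obtain ⟨ini, hini, hout⟩ := hD.initial
  refine ⟨ini i, (hini i).2.2, fun q hq hi l => ?_⟩
  by_cases hl : l ∈ Set.range ini
  · obtain ⟨j, rfl⟩ := hl
    rw [(hini j).2.1, mem_hyperplane_single_iff hd, ini.apply_eq_iff_eq]
    refine ⟨fun hj => ?_, fun h => h ▸ hi⟩
    by_contra hne
    fin_cases i <;> fin_cases j <;> simp_all
  · refine iff_of_false ((hout l hl).notMem ha hb hd hq) ?_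
    rintro rfl
    exact hl ⟨i, rfl⟩

theorem localFn_of_pos {q : Fin 2 → ℝ} (h0 : 0 < q 0) (h1 : q 1 ≠ 0) : D.localFn q = 1 := by
  refine D.localFn_eq_one fun l hl => ?_
  obtain ⟨ini, hini, hout⟩ := hD.initial
  by_cases hr : l ∈ Set.range ini
  · obtain ⟨j, rfl⟩ := hr
    rw [(hini j).2.1, mem_hyperplane_single_iff hd] at hl
    fin_cases j
    · exact h0.ne' hl
    · exact h1 hl
  · exact (hout l hr).notMem ha hb hd (Or.inl h0) hl

theorem localFn_of_one_eq_zero {q : Fin 2 → ℝ} (h0 : 0 < q 0) (h1 : q 1 = 0) :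
    D.localFn q = 1 + MvPowerSeries.X 1 := by
  obtain ⟨j, hj, h⟩ := exists_initial_wall ha hb hd hD 1
  rw [D.localFn_eq_fn (h q (Or.inl h0) h1), hj]

theorem localFn_of_zero_eq_zero {q : Fin 2 → ℝ} (h0 : q 0 = 0) (h1 : q 1 ≠ 0) :
    D.localFn q = 1 + MvPowerSeries.X 0 := by
  have hneg : ∀ q : Fin 2 → ℝ, q 0 = 0 → q 1 < 0 → D.localFn q = 1 + MvPowerSeries.X 0 := by
    intro q h0 h1
    obtain ⟨j, hj, h⟩ := exists_initial_wall ha hb hd hD 0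
    rw [D.localFn_eq_fn (h q (Or.inr h1) h0), hj]
  rcases lt_or_gt_of_ne h1 with h1 | h1
  · exact hneg q h0 h1
  -- On the upper half-axis, rescale to the point reached by the arc. Coefficients with e_1 = 0 come
  -- from the lower half by consistency; the others vanish because all walls here have root α_0.
  have hq : q = (q 1 * (3 / 2)) • ![0, 2 / 3] := by
    funext i
    fin_cases i
    · simp [h0]
    · simp
      ring
  rw [hq, D.localFn_smul _ (by positivity)]
  ext e
  by_cases he : e 1 = 0
  · rw [hD.consistent.coeff_localFn_eq hd.pos D he, hneg _ rfl (by simp)]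
  · rw [D.coeff_localFn_eq_zero (fun i hi => ?_) he, map_add, MvPowerSeries.coeff_one,
      MvPowerSeries.coeff_X, if_neg, if_neg, add_zero]
    · rintro rfl
      simp at he
    · rintro rfl
      simp at he
    · refine (Wall.root_one_eq_zero_iff hd.pos _ hi fun h => ?_).2 rfl
      have := congrFun h 1
      norm_num at this

omit ha hb hD in
theorem X_dvd_localFn_sub_one_of_neg {q : Fin 2 → ℝ} (h0 : q 0 < 0) :
    (MvPowerSeries.X 1 : MvPowerSeries (Fin 2) k) ∣ D.localFn q - 1 := by
  refine D.X_dvd_localFn_sub_one fun i hi h => h0.ne ?_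
  exact (Wall.root_one_eq_zero_iff hd.pos _ hi fun h => by simp [h] at h0).1 h

end LocalFunctions

/-! ### Broken lines traced back from their endpoint -/

section General

variable {k : Type*} [Field k] {n : ℕ} {d : Fin n → ℕ} {ι : Type*}
  {B : Matrix (Fin n) (Fin n) ℤ} {D : ScatteringDiagram k d ι} {p : Fin n → ℝ} {lam : Fin n → ℤ}

/-- The position of a broken line at its `j`-th point of nonlinearity. -/
def BrokenLine.bendPoint (γ : BrokenLine B D p lam) (j : Fin γ.bends) : Fin n → ℝ :=
  γ.path ⟨γ.time j, Set.mem_Iic.2 (γ.time_neg j).le⟩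

theorem BrokenLine.path_castSucc (γ : BrokenLine B D p lam) (j : Fin γ.bends) (s : Set.Iic (0 : ℝ))
    (hs : ∀ i : Fin γ.bends, (i : ℕ) < j → γ.time i ≤ s) (hs' : (s : ℝ) ≤ γ.time j) (l : Fin n) :
    γ.path s l = γ.bendPoint j l + (γ.time j - s) * γ.wt j.castSucc l := by
  have := γ.linear j.castSucc s ⟨γ.time j, Set.mem_Iic.2 (γ.time_neg j).le⟩
    (fun i hi => ⟨hs i hi, γ.time_strictMono.monotone (Fin.le_def.2 (le_of_lt hi))⟩)
    (fun i hi => ⟨hs'.trans (γ.time_strictMono.monotone hi), γ.time_strictMono.monotone hi⟩) l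
  rw [BrokenLine.bendPoint]
  linear_combination -this

theorem BrokenLine.path_last (γ : BrokenLine B D p lam) (s : Set.Iic (0 : ℝ))
    (hs : ∀ i : Fin γ.bends, γ.time i ≤ s) (l : Fin n) :
    γ.path s l = p l - s * γ.wt (Fin.last _) l := by
  have := γ.linear (Fin.last _) s ⟨0, Set.mem_Iic.2 le_rfl⟩
    (fun i _ => ⟨hs i, (γ.time_neg i).le⟩)
    (fun i hi => absurd i.2 (not_lt.2 hi)) l
  rw [γ.path_zero] at this
  linear_combination -this

/-- The position at a bend from which the broken line runs straight to its endpoint. -/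
theorem BrokenLine.bendPoint_of_last (γ : BrokenLine B D p lam) (j : Fin γ.bends)
    (hj : (j : ℕ) + 1 = γ.bends) (l : Fin n) :
    γ.bendPoint j l = p l - γ.time j * γ.wt (Fin.last _) l :=
  γ.path_last _ (fun i => γ.time_strictMono.monotone (Fin.le_def.2 (by omega))) l

theorem BrokenLine.bendPoint_consecutive (γ : BrokenLine B D p lam) (j j' : Fin γ.bends)
    (hj : (j : ℕ) + 1 = j') (l : Fin n) :
    γ.bendPoint j l = γ.bendPoint j' l + (γ.time j' - γ.time j) * γ.wt j'.castSucc l :=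
  γ.path_castSucc j' ⟨γ.time j, Set.mem_Iic.2 (γ.time_neg j).le⟩
    (fun i hi => γ.time_strictMono.monotone (Fin.le_def.2 (by omega)))
    (γ.time_strictMono.monotone (Fin.le_def.2 (by omega))) l

/-- A broken line is determined by its bending times and its monomials. -/
theorem BrokenLine.eq_of_data (γ γ' : BrokenLine B D p lam) (hb : γ.bends = γ'.bends)
    (ht : ∀ j, γ.time j = γ'.time (Fin.cast hb j))
    (hc : ∀ i, γ.coeff i = γ'.coeff (Fin.cast (by rw [hb]) i))
    (hw : ∀ i, γ.wt i = γ'.wt (Fin.cast (by rw [hb]) i))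
    (hr : ∀ i, γ.rt i = γ'.rt (Fin.cast (by rw [hb]) i)) : γ = γ' := by
  -- The paths are compared on one domain of linearity after another, backwards from the common
  -- endpoint.
  have hpath : ∀ i : Fin (γ.bends + 1), ∀ s : Set.Iic (0 : ℝ),
      (∀ j : Fin γ.bends, (j : ℕ) < i → γ.time j ≤ s) → γ.path s = γ'.path s := by
    intro i
    induction i using Fin.reverseInduction with
    | last =>
      intro s hs
      funext l
      rw [γ.path_last s (fun j => hs j (by simp)) l, γ'.path_last s (fun j => ?_) l, hw]
      · congr 4
        exact Fin.ext hb
      · have := hs (Fin.cast hb.symm j) (by simp [hb])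
        rwa [ht] at this
    | cast j ih =>
      intro s hs
      by_cases hj : γ.time j ≤ s
      · refine ih s fun i hi => ?_
        rcases Nat.lt_succ_iff_lt_or_eq.1 (show (i : ℕ) < j + 1 from hi) with h | h
        · exact hs i h
        · rwa [Fin.ext h]
      · have hj := (not_le.1 hj).le
        funext l
        rw [γ.path_castSucc j s hs hj l, γ'.path_castSucc (Fin.cast hb j) s (fun i hi => ?_) ?_ l,
          ← ht, hw]
        rotate_left
        · rwa [← ht]
        · have := hs (Fin.cast hb.symm i) hi
          rwa [ht] at this
        · congr 1
          have := ih ⟨γ.time j, Set.mem_Iic.2 (γ.time_neg j).le⟩ fun i hi =>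
            γ.time_strictMono.monotone (Fin.le_def.2 (Nat.lt_succ_iff.1 hi))
          rw [BrokenLine.bendPoint, this, BrokenLine.bendPoint]
          simp only [ht]
  have hpath : γ.path = γ'.path := funext fun s => hpath 0 s fun j hj => absurd hj (by simp)
  obtain ⟨n, t, c, w, r, f, _, _, _, _, _, _, _, _, _⟩ := γ
  obtain ⟨n', t', c', w', r', f', _, _, _, _, _, _, _, _, _⟩ := γ'
  obtain rfl : n = n' := hb
  obtain rfl : t = t' := funext ht
  obtain rfl : c = c' := funext hc
  obtain rfl : w = w' := funext hw
  obtain rfl : r = r' := funext hr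
  obtain rfl : f = f' := hpath
  rfl

/-- If a coordinate of the direction is nonpositive from a bend on, then that coordinate of the position is
at least that of the endpoint. -/
theorem BrokenLine.le_bendPoint (γ : BrokenLine B D p lam) (l : Fin n) (j : Fin γ.bends)
    (h : ∀ i : Fin (γ.bends + 1), j.succ ≤ i → 0 ≤ γ.wt i l) : p l ≤ γ.bendPoint j l := by
  have key : ∀ i : Fin (γ.bends + 1), ∀ j : Fin γ.bends, j.succ = i →
      (∀ i : Fin (γ.bends + 1), j.succ ≤ i → 0 ≤ γ.wt i l) → p l ≤ γ.bendPoint j l := by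
    intro i
    induction i using Fin.reverseInduction with
    | last =>
      intro j hj h
      have hw : (0 : ℝ) ≤ γ.wt (Fin.last _) l := by exact_mod_cast h _ (Fin.le_last _)
      rw [γ.bendPoint_of_last j (by simpa using congrArg Fin.val hj)]
      nlinarith [γ.time_neg j]
    | cast j' ih =>
      intro j hj h
      have hjj : (j : ℕ) + 1 = j' := congrArg Fin.val hj
      have hw : (0 : ℝ) ≤ γ.wt j'.castSucc l := by exact_mod_cast h _ hj.le
      have := ih j' rfl fun i hi => h i ((Fin.le_def.2 (by simp; omega)).trans hi)
      have ht : γ.time j ≤ γ.time j' := γ.time_strictMono.monotone (Fin.le_def.2 (by omega))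
      rw [γ.bendPoint_consecutive j j' hjj]
      nlinarith
  exact key _ j rfl h

end General

theorem coeff_one_add_X_pow {k : Type*} [Field k] {σ : Type*} (i : σ) (n : ℕ) (e : σ →₀ ℕ)
    (he : e = Finsupp.single i (e i)) :
    MvPowerSeries.coeff e ((1 + MvPowerSeries.X i : MvPowerSeries σ k) ^ n) = n.choose (e i) := by
  classical
  rw [add_comm, add_pow, map_sum]
  simp only [one_pow, mul_one]
  have : ∀ m, MvPowerSeries.coeff e ((MvPowerSeries.X i : MvPowerSeries σ k) ^ m * (n.choose m : MvPowerSeries σ k)) =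
      if e i = m then (n.choose m : k) else 0 := by
    intro m
    rw [mul_comm, ← nsmul_eq_mul, map_nsmul, MvPowerSeries.coeff_X_pow, nsmul_eq_mul]
    by_cases h : e i = m
    · rw [if_pos h, if_pos (by rw [← h]; exact he), mul_one]
    · rw [if_neg h, if_neg, mul_zero]
      intro h'
      exact h (by rw [h']; simp)
  simp only [this, Finset.sum_ite_eq, Finset.mem_range]
  split_ifs with h
  · rfl
  · rw [Nat.choose_eq_zero_of_lt (by omega), Nat.cast_zero]

theorem eq_single_of_coeff_ne_zero {k : Type*} [Field k] {σ : Type*} (i : σ) (n : ℕ) (e : σ →₀ ℕ)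
    (he : MvPowerSeries.coeff e ((1 + MvPowerSeries.X i : MvPowerSeries σ k) ^ n) ≠ 0) :
    e = Finsupp.single i (e i) := by
  classical
  rw [add_comm, add_pow, map_sum] at he
  obtain ⟨m, -, hm⟩ := Finset.exists_ne_zero_of_sum_ne_zero he
  rw [one_pow, mul_one, mul_comm, ← nsmul_eq_mul, map_nsmul, MvPowerSeries.coeff_X_pow] at hm
  split_ifs at hm with h
  · rw [h]
    simp
  · simp at hm

/-! ### Possible bends in the plane -/

section Planar

variable {k : Type*} [Field k] {a b : ℤ} (ha : a < 0) (hb : 0 < b)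
  {d : Fin 2 → ℕ} (hd : IsSkewSymmetrizer !![0, b; a, 0] d) {ι : Type*}
  {D : ScatteringDiagram k d ι} (hD : IsTransposedClusterScattering !![0, b; a, 0] D)
  {p : Fin 2 → ℝ}

theorem omegaVec_fin_two (a b : ℤ) (e : Fin 2 → ℕ) :
    omegaVec !![0, b; a, 0] e = ![b * e 1, a * e 0] := by
  funext i
  fin_cases i <;> simp [omegaVec, Matrix.mulVec, dotProduct, Fin.sum_univ_two, toQ]

include hd in
theorem IsGenericEndpoint.pos (hp : IsGenericEndpoint d p) (i : Fin 2) : 0 < p i := by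
  have h := (hp.1 i).lt_of_ne (hp.2 _ fun h => by simpa using congrFun h i).symm
  have h0 : (0 : ℝ) < d 0 := by exact_mod_cast hd.pos 0
  have h1 : (0 : ℝ) < d 1 := by exact_mod_cast hd.pos 1
  rw [rootPairing_fin_two] at h
  fin_cases i
  · simpa [h0] using h
  · simpa [h1] using h

-- A line of integer direction `w` through `p` and the origin would make `p` orthogonal to a nonzero
-- vector of the root lattice.
include hd in
theorem IsGenericEndpoint.add_smul_ne_zero (hp : IsGenericEndpoint d p) (w : Fin 2 → ℤ) (r : ℝ)
    {x : Fin 2 → ℝ} (hx : ∀ l, x l = p l - r * w l) : x ≠ 0 := by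
  rintro rfl
  have h0 : (d 0 : ℝ) ≠ 0 := by exact_mod_cast (hd.pos 0).ne'
  have h1 : (d 1 : ℝ) ≠ 0 := by exact_mod_cast (hd.pos 1).ne'
  have e0 := hx 0
  have e1 := hx 1
  simp only [Pi.zero_apply] at e0 e1
  have hw0 : w 0 ≠ 0 := by
    intro h
    have := hp.pos hd 0
    rw [h] at e0
    simp at e0
    linarith
  -- The factors `d i` cancel in the pairing, leaving the determinant of `p` and `w`.
  refine hp.2 ![d 0 * w 1, -(d 1 * w 0)] (fun h => ?_) ?_
  · have := congrFun h 1
    simp [hw0, (hd.pos 1).ne'] at this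
  · rw [rootPairing_fin_two]
    simp
    field_simp
    linear_combination -w 1 * e0 + w 0 * e1

include hd hD in
/-- Walls through a nonzero point of the coordinate axis `q i = 0` lie on that axis. -/
theorem coord_eq_zero_of_mem_wall {q : Fin 2 → ℝ} (hq : q ≠ 0) {i : Fin 2} (hi : q i = 0) {l : ι}
    (hl : q ∈ (D.wall l).carrier) {q' : Fin 2 → ℝ} (hq' : q' ∈ (D.wall l).carrier) : q' i = 0 := by
  obtain ⟨ini, hini, -⟩ := hD.initial
  have hroot : (D.wall l).root = (D.wall (ini i)).root := by
    by_contra hne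
    refine hq (Wall.eq_zero_of_mem_inter hd.pos _ _ hne ⟨hl, ?_⟩)
    rw [(hini i).2.1, mem_hyperplane_single_iff hd, hi]
  have := (D.wall l).rootPairing_eq_zero hq'
  rw [hroot, (hini i).1] at this
  exact (mem_hyperplane_single_iff hd q' i).1 this

theorem eq_one_or_eq_neg_one_of_gcd {v : Fin 2 → ℤ} (hv : Finset.univ.gcd v = 1) {i j : Fin 2}
    (hij : i ≠ j) (hj : v j = 0) : v i = 1 ∨ v i = -1 := by
  rw [show (Finset.univ : Finset (Fin 2)) = {0, 1} from rfl, Finset.gcd_insert,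
    Finset.gcd_singleton] at hv
  fin_cases i <;> fin_cases j <;> simp_all
  · rwa [← Int.abs_eq_normalize, abs_eq (by norm_num)] at hv
  · rwa [← Int.abs_eq_normalize, abs_eq (by norm_num)] at hv

-- The origin lies on both initial walls, which are not parallel.
include hd hD in
theorem BrokenLine.bendPoint_ne_zero {lam : Fin 2 → ℤ}
    (γ : BrokenLine !![0, b; a, 0] D p lam) (j : Fin γ.bends) : γ.bendPoint j ≠ 0 := by
  intro h
  obtain ⟨ini, hini, -⟩ := hD.initial
  refine γ.avoids_intersections ⟨γ.time j, Set.mem_Iic.2 (γ.time_neg j).le⟩ (ini 0) (ini 1) ?_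
    ⟨?_, ?_⟩
  · rw [(hini 0).1, (hini 1).1]
    intro h
    simpa using congrFun h 0
  · change γ.bendPoint j ∈ _
    rw [h, (hini 0).2.1, mem_hyperplane_single_iff hd]
    rfl
  · change γ.bendPoint j ∈ _
    rw [h, (hini 1).2.1, mem_hyperplane_single_iff hd]
    rfl

-- The local function decides which terms ŷ^e are available. To the left of the axis q_0 = 0 only
-- e_1 > 0 is recorded, which is all that is needed to exclude such bends. Absolute values appear
-- because the primitive normal is determined only up to sign.
include ha hb hd hD in
theorem BrokenLine.bend_cases {lam : Fin 2 → ℤ} (γ : BrokenLine !![0, b; a, 0] D p lam)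
    (j : Fin γ.bends) : ∃ e : Fin 2 → ℕ,
    γ.wt j.succ = ![γ.wt j.castSucc 0 + b * e 1, γ.wt j.castSucc 1 + a * e 0] ∧
    γ.rt j.succ = ![γ.rt j.castSucc 0 + e 0, γ.rt j.castSucc 1 + e 1] ∧
    ((γ.bendPoint j 0 < 0 ∧ 0 < e 1) ∨
     (γ.bendPoint j 0 = 0 ∧ e 1 = 0 ∧ 0 < e 0 ∧ e 0 ≤ (γ.wt j.castSucc 0).natAbs ∧
        γ.coeff j.succ = γ.coeff j.castSucc * ((γ.wt j.castSucc 0).natAbs.choose (e 0) : ℕ)) ∨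
     (0 < γ.bendPoint j 0 ∧ γ.bendPoint j 1 = 0 ∧ e 0 = 0 ∧ 0 < e 1 ∧
        e 1 ≤ (γ.wt j.castSucc 1).natAbs ∧
        γ.coeff j.succ = γ.coeff j.castSucc * ((γ.wt j.castSucc 1).natAbs.choose (e 1) : ℕ))) := by
  obtain ⟨v, hv, hnormal, hpos, e, c, hc0, hc, hcoeff, hwt, hrt⟩ := γ.bend j
  change ∀ i, γ.bendPoint j ∈ _ → _ at hnormal
  change c = MvPowerSeries.coeff e (D.localFn (γ.bendPoint j) ^ _) at hc
  have he : e ≠ 0 := by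
    rintro rfl
    refine γ.nonlinear j ?_
    rw [hwt, omegaVec_fin_two]
    funext i
    fin_cases i <;> simp
  have hne := γ.bendPoint_ne_zero hd hD j
  refine ⟨e, ?_, ?_, ?_⟩
  · rw [hwt, omegaVec_fin_two]
    funext i
    fin_cases i <;> simp
  · rw [hrt]
    funext i
    fin_cases i <;> simp [toQ]
  have key : ∀ i i' : Fin 2, i ≠ i' → γ.bendPoint j i = 0 →
      D.localFn (γ.bendPoint j) = 1 + MvPowerSeries.X i →
      e i' = 0 ∧ 0 < e i ∧ e i ≤ (γ.wt j.castSucc i).natAbs ∧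
        γ.coeff j.succ = γ.coeff j.castSucc * ((γ.wt j.castSucc i).natAbs.choose (e i) : ℕ) := by
    intro i i' hii h0 hloc
    obtain ⟨l, hl⟩ := exists_wall_of_coord_eq_zero hd hD i
    -- Some wall is the whole axis, so a vector normal to it is supported on the index `i`.
    have hv' : v i' = 0 := by
      have := hnormal l ((hl _).2 h0) (Pi.single i' 1) ((hl _).2 (by simp [hii]))
      simpa [Pi.single_apply] using this
    have hsum : ∑ l, γ.wt j.castSucc l * v l = γ.wt j.castSucc i * v i := by
      refine Finset.sum_eq_single i (fun m _ hm => ?_) (by simp)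
      have : m = i' := by
        fin_cases i <;> fin_cases i' <;> fin_cases m <;> simp_all
      rw [this, hv', mul_zero]
    have habs : (∑ l, γ.wt j.castSucc l * v l).toNat = (γ.wt j.castSucc i).natAbs := by
      rw [hsum] at hpos ⊢
      rcases eq_one_or_eq_neg_one_of_gcd hv hii hv' with h | h <;> rw [h] at hpos ⊢ <;> omega
    rw [hloc, habs] at hc
    have hes := eq_single_of_coeff_ne_zero (k := k) i _ e (hc ▸ hc0)
    rw [coeff_one_add_X_pow i _ e hes] at hc
    refine ⟨?_, ?_, ?_, ?_⟩
    · rw [hes]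
      simp [hii]
    · rw [Nat.pos_iff_ne_zero]
      intro h
      rw [h] at hes
      exact he (by simpa using hes)
    · by_contra! h
      rw [Nat.choose_eq_zero_of_lt h] at hc
      exact hc0 (by simpa using hc)
    · rw [hcoeff, hc]
  rcases lt_trichotomy (γ.bendPoint j 0) 0 with h0 | h0 | h0
  · left
    refine ⟨h0, ?_⟩
    rw [Nat.pos_iff_ne_zero]
    intro h1
    have hX : (MvPowerSeries.X 1 : MvPowerSeries (Fin 2) k) ∣
        D.localFn (γ.bendPoint j) ^ (∑ l, γ.wt j.castSucc l * v l).toNat - 1 :=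
      (X_dvd_localFn_sub_one_of_neg hd h0).trans (by
        have := sub_dvd_pow_sub_pow (D.localFn (γ.bendPoint j)) 1
          (∑ l, γ.wt j.castSucc l * v l).toNat
        rwa [one_pow] at this)
    have := MvPowerSeries.X_dvd_iff.1 hX e h1
    rw [map_sub, ← hc, MvPowerSeries.coeff_one, if_neg he, sub_zero] at this
    exact hc0 this
  · right; left
    have h1 : γ.bendPoint j 1 ≠ 0 := fun h1 => hne (funext fun i => by
      fin_cases i <;> simp [h0, h1])
    exact ⟨h0, key 0 1 (by simp) h0 (localFn_of_zero_eq_zero ha hb hd hD h0 h1)⟩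
  · right; right
    by_cases h1 : γ.bendPoint j 1 = 0
    · exact ⟨h0, h1, key 1 0 (by simp) h1 (localFn_of_one_eq_zero ha hb hd hD h0 h1)⟩
    · rw [localFn_of_pos ha hb hd hD h0 h1, one_pow, MvPowerSeries.coeff_one, if_neg he] at hc
      exact absurd hc hc0

end Planar

/-- The number of bends of the broken line with final `y`-exponent `(x, y)`. -/
def lineBends (x y : ℕ) : ℕ := if y = 0 then (if x = 0 then 0 else 1) else 2

/-- The exponents of `x` along the broken line with final `y`-exponent `(x, y)`. -/
def lineWt (a b m₁ m₂ : ℤ) (x y i : ℕ) : Fin 2 → ℤ :=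
  ![m₁ + b * (if 2 ≤ i then y else 0), m₂ + a * (if 1 ≤ i then x else 0)]

/-- The exponents of `y` along the broken line with final `y`-exponent `(x, y)`. -/
def lineRt (x y i : ℕ) : Fin 2 → ℤ := ![if 1 ≤ i then x else 0, if 2 ≤ i then y else 0]

theorem lineRt_zero (x y : ℕ) : lineRt x y 0 = 0 := by
  funext i
  fin_cases i <;> simp [lineRt]

/-- The coefficients along the broken line with final `y`-exponent `(x, y)`. -/
def lineCoeff (k : Type*) [Field k] (a m₁ m₂ : ℤ) (x y i : ℕ) : k :=
  (if 1 ≤ i then ((-m₁).toNat.choose x : k) else 1) *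
    (if 2 ≤ i then ((-m₂ - a * x).toNat.choose y : k) else 1)

/-- The bending times of the broken line with final `y`-exponent `(x, y)` and endpoint `p`. -/
noncomputable def lineTime (a b m₁ m₂ : ℤ) (p : Fin 2 → ℝ) (x y j : ℕ) : ℝ :=
  if y = 0 then p 0 / m₁
  else if j = 0 then
    p 1 / (m₂ + a * x) + (p 0 - p 1 / (m₂ + a * x) * (m₁ + b * y)) / m₁
  else p 1 / (m₂ + a * x)

/-! ### Classification of the broken lines -/

section Classification

variable {k : Type*} [Field k] {a b : ℤ} (ha : a < 0) (hb : 0 < b)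
  {d : Fin 2 → ℕ} (hd : IsSkewSymmetrizer !![0, b; a, 0] d) {ι : Type*}
  {D : ScatteringDiagram k d ι} (hD : IsTransposedClusterScattering !![0, b; a, 0] D)
  {p : Fin 2 → ℝ} (hp : IsGenericEndpoint d p) {m₁ m₂ : ℤ} (hbm : -b ≤ m₁)

include ha hb hd hD in
theorem BrokenLine.wt_zero_monotone {lam : Fin 2 → ℤ} (γ : BrokenLine !![0, b; a, 0] D p lam) :
    Monotone fun i => γ.wt i 0 := by
  refine Fin.monotone_iff_le_succ.2 fun j => ?_
  obtain ⟨e, hw, -, -⟩ := γ.bend_cases ha hb hd hD j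
  rw [hw]
  simp only [Matrix.cons_val_zero, le_add_iff_nonneg_right]
  positivity

-- The first exponent never decreases, so from this bend on the line does not move to the right; it
-- ends at p_0 > 0, so it was already there.
include ha hb hd hD hp in
theorem BrokenLine.bendPoint_zero_of_wt_nonneg {lam : Fin 2 → ℤ}
    (γ : BrokenLine !![0, b; a, 0] D p lam) (j : Fin γ.bends) (h : 0 ≤ γ.wt j.succ 0) :
    0 < γ.bendPoint j 0 :=
  (hp.pos hd 0).trans_le (γ.le_bendPoint 0 j fun _ hi =>
    h.trans (γ.wt_zero_monotone ha hb hd hD hi))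

include ha hb hd hD in
theorem BrokenLine.le_wt_zero (γ : BrokenLine !![0, b; a, 0] D p ![m₁, m₂])
    (i : Fin (γ.bends + 1)) : m₁ ≤ γ.wt i 0 := by
  have := γ.wt_zero_monotone ha hb hd hD (Fin.zero_le i)
  simpa [γ.initial.2.1] using this

include ha hb hd hD hp

theorem BrokenLine.bend_on_first_axis (γ : BrokenLine !![0, b; a, 0] D p ![m₁, m₂])
    (j : Fin γ.bends) (h : γ.bendPoint j 0 = 0) : ∃ e : ℕ,
      γ.wt j.succ = ![γ.wt j.castSucc 0, γ.wt j.castSucc 1 + a * e] ∧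
      γ.rt j.succ = ![γ.rt j.castSucc 0 + e, γ.rt j.castSucc 1] ∧
      0 < e ∧ e ≤ (-γ.wt j.castSucc 0).toNat ∧
      γ.coeff j.succ = γ.coeff j.castSucc * ((-γ.wt j.castSucc 0).toNat.choose e : ℕ) ∧
      γ.wt j.castSucc 0 < 0 := by
  obtain ⟨e, hw, hr, ⟨h0, -⟩ | ⟨-, h1, h0, hle, hc⟩ | ⟨h0, -⟩⟩ := γ.bend_cases ha hb hd hD j
  · exact absurd h h0.ne
  · have hneg : γ.wt j.castSucc 0 < 0 := by
      by_contra! hn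
      refine (γ.bendPoint_zero_of_wt_nonneg ha hb hd hD hp j ?_).ne' h
      rw [hw]
      simpa [h1] using hn
    have habs : (γ.wt j.castSucc 0).natAbs = (-γ.wt j.castSucc 0).toNat := by omega
    rw [habs] at hle hc
    exact ⟨e 0, by simpa [h1] using hw, by simpa [h1] using hr, h0, hle, hc, hneg⟩
  · exact absurd h h0.ne'

include hbm

/-- This is where -b ≤ m₁ first enters: a bend with q_0 < 0 adds at least b to the first exponent,
making it nonnegative, and then the line cannot reach `p`. -/
theorem BrokenLine.bendPoint_zero_nonneg (γ : BrokenLine !![0, b; a, 0] D p ![m₁, m₂])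
    (j : Fin γ.bends) : 0 ≤ γ.bendPoint j 0 := by
  by_contra! h
  refine h.not_gt (γ.bendPoint_zero_of_wt_nonneg ha hb hd hD hp j ?_)
  obtain ⟨e, hw, -, ⟨-, he⟩ | h' | h'⟩ := γ.bend_cases ha hb hd hD j
  · have h0 := γ.le_wt_zero ha hb hd hD j.castSucc
    rw [hw]
    simp only [Matrix.cons_val_zero]
    have : b * 1 ≤ b * e 1 := by gcongr; exact_mod_cast he
    linarith
  · exact absurd h'.1 h.ne
  · exact absurd h'.1 h.not_gt

/-- Before such a bend the first exponent is negative, so the line arrives from q_0 < 0, and a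
preceding bend would lie there. -/
theorem BrokenLine.eq_zero_of_bendPoint (γ : BrokenLine !![0, b; a, 0] D p ![m₁, m₂])
    (j : Fin γ.bends) (h : γ.bendPoint j 0 = 0) : (j : ℕ) = 0 := by
  by_contra hj
  obtain ⟨e, hw, -, -, -, -, hneg⟩ := γ.bend_on_first_axis ha hb hd hD hp j h
  have hjb := j.2
  have hnn := γ.bendPoint_zero_nonneg ha hb hd hD hp hbm ⟨j - 1, by omega⟩
  rw [γ.bendPoint_consecutive ⟨j - 1, by omega⟩ j (by simp; omega), h] at hnn
  have ht : γ.time ⟨j - 1, by omega⟩ < γ.time j :=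
    γ.time_strictMono (Fin.lt_def.2 (by simp; omega))
  have hneg : (γ.wt j.castSucc 0 : ℝ) < 0 := by exact_mod_cast hneg
  nlinarith

/-- After this bend the first exponent is at least m₁ + b ≥ 0, so a later bend would again have q_0
> 0 and lie on q_1 = 0. -/
theorem BrokenLine.bend_on_second_axis (γ : BrokenLine !![0, b; a, 0] D p ![m₁, m₂])
    (j : Fin γ.bends) (h : 0 < γ.bendPoint j 0) : ∃ e : ℕ, (j : ℕ) + 1 = γ.bends ∧
      γ.wt j.succ = ![γ.wt j.castSucc 0 + b * e, γ.wt j.castSucc 1] ∧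
      γ.rt j.succ = ![γ.rt j.castSucc 0, γ.rt j.castSucc 1 + e] ∧
      0 < e ∧ e ≤ (-γ.wt j.castSucc 1).toNat ∧
      γ.coeff j.succ = γ.coeff j.castSucc * ((-γ.wt j.castSucc 1).toNat.choose e : ℕ) ∧
      γ.wt j.castSucc 1 < 0 ∧ γ.bendPoint j 1 = 0 := by
  obtain ⟨e, hw, hr, ⟨h0, -⟩ | ⟨h0, -⟩ | ⟨-, h0, h1, he, hle, hc⟩⟩ := γ.bend_cases ha hb hd hD j
  · exact absurd h h0.not_gt
  · exact absurd h0 h.ne'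
  have hw0 : 0 ≤ γ.wt j.succ 0 := by
    have h0 := γ.le_wt_zero ha hb hd hD j.castSucc
    rw [hw]
    simp only [Matrix.cons_val_zero]
    have : b * 1 ≤ b * e 1 := by gcongr; exact_mod_cast he
    linarith
  have hw1 : γ.wt j.succ 1 = γ.wt j.castSucc 1 := by simp [hw, h1]
  have hlast : (j : ℕ) + 1 = γ.bends := by
    by_contra hne
    have hj : (j : ℕ) + 1 < γ.bends := by omega
    have hs : (⟨j + 1, hj⟩ : Fin γ.bends).castSucc = j.succ := rfl
    have hpos : 0 < γ.bendPoint ⟨j + 1, hj⟩ 0 :=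
      γ.bendPoint_zero_of_wt_nonneg ha hb hd hD hp _
        (hw0.trans (γ.wt_zero_monotone ha hb hd hD (Fin.le_def.2 (by simp))))
    obtain ⟨e', -, -, ⟨h0', -⟩ | ⟨h0', -⟩ | ⟨-, h0', -, he', hle', -⟩⟩ :=
      γ.bend_cases ha hb hd hD ⟨j + 1, hj⟩
    · exact hpos.not_gt h0'
    · exact hpos.ne' h0'
    · have hb := γ.bendPoint_consecutive j ⟨j + 1, hj⟩ rfl 1
      have ht : γ.time j < γ.time ⟨j + 1, hj⟩ := γ.time_strictMono (Fin.lt_def.2 (by simp))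
      rw [h0, h0', zero_add] at hb
      -- Moving along the axis forces the second exponent to vanish, and (1 + ŷ_1)^0 offers no term
      -- to bend with.
      have hz : (γ.wt (⟨j + 1, hj⟩ : Fin γ.bends).castSucc 1 : ℝ) = 0 := by
        rcases mul_eq_zero.1 hb.symm with h | h
        · linarith
        · exact h
      rw [Int.cast_eq_zero.1 hz] at hle'
      simp at hle'
      omega
  -- The last segment climbs from q_1 = 0 to p_1 > 0.
  have hneg : γ.wt j.castSucc 1 < 0 := by
    have hl := γ.bendPoint_of_last j hlast 1
    rw [h0, show Fin.last γ.bends = j.succ from Fin.ext (by simp [hlast]), hw1] at hl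
    have hp1 := hp.pos hd 1
    by_contra! hn
    have hn : (0 : ℝ) ≤ γ.wt j.castSucc 1 := by exact_mod_cast hn
    nlinarith [γ.time_neg j]
  have habs : (γ.wt j.castSucc 1).natAbs = (-γ.wt j.castSucc 1).toNat := by omega
  rw [habs] at hle hc
  exact ⟨e 1, hlast, by simpa [h1] using hw, by simpa [h1] using hr, he, hle, hc, hneg, h0⟩

theorem BrokenLine.classification (hm₂ : 0 ≤ m₂)
    (γ : BrokenLine !![0, b; a, 0] D p ![m₁, m₂]) :
    ∃ x y : ℕ, x ≤ (-m₁).toNat ∧ y ≤ (-m₂ - a * x).toNat ∧ γ.bends = lineBends x y ∧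
      (∀ j, γ.time j = lineTime a b m₁ m₂ p x y j) ∧
      (∀ i, γ.coeff i = lineCoeff k a m₁ m₂ x y i) ∧
      (∀ i, γ.wt i = lineWt a b m₁ m₂ x y i) ∧ ∀ i, γ.rt i = lineRt x y i := by
  obtain ⟨c0, w0, r0⟩ := γ.initial
  have hcase : ∀ j, γ.bendPoint j 0 = 0 ∨ 0 < γ.bendPoint j 0 := fun j =>
    (γ.bendPoint_zero_nonneg ha hb hd hD hp hbm j).eq_or_lt.imp Eq.symm id
  have hz : ∀ i : Fin (γ.bends + 1), (i : ℕ) = 0 → i = 0 := fun i hi => Fin.ext hi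
  rcases Nat.eq_zero_or_pos γ.bends with hb0 | hpos
  · have h0 : ∀ i : Fin (γ.bends + 1), i = 0 := fun i => hz i (by omega)
    refine ⟨0, 0, by simp, by simp, by simp [hb0, lineBends], fun j => absurd j.2 (by omega),
      fun i => ?_, fun i => ?_, fun i => ?_⟩
    · simp [h0 i, c0, lineCoeff]
    · simp [h0 i, w0, lineWt]
    · rw [h0 i, r0, Fin.val_zero, lineRt_zero]
  -- A first bend on the second axis would need a negative second exponent, but that is still m₂ ≥
  -- 0.
  have h0 : γ.bendPoint ⟨0, hpos⟩ 0 = 0 := by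
    refine (hcase ⟨0, hpos⟩).resolve_right fun h => ?_
    obtain ⟨e, -, -, -, -, -, -, hneg, -⟩ :=
      γ.bend_on_second_axis ha hb hd hD hp hbm ⟨0, hpos⟩ h
    have : γ.wt (Fin.castSucc ⟨0, hpos⟩) = ![m₁, m₂] := w0
    rw [this] at hneg
    exact absurd hneg (by simpa using hm₂)
  obtain ⟨x, hw, hr, hx, hxle, hc, hneg⟩ := γ.bend_on_first_axis ha hb hd hD hp ⟨0, hpos⟩ h0
  rw [show Fin.castSucc ⟨0, hpos⟩ = (0 : Fin (γ.bends + 1)) from rfl] at hw hr hxle hc hneg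
  simp only [w0, r0, c0, Matrix.cons_val_zero, Matrix.cons_val_one, Pi.zero_apply, zero_add,
    one_mul] at hw hr hxle hc hneg
  have hm1 : (m₁ : ℝ) ≠ 0 := by exact_mod_cast hneg.ne
  rcases Nat.lt_or_ge 1 γ.bends with h1 | h1
  · have hpos1 : 0 < γ.bendPoint ⟨1, h1⟩ 0 := (hcase ⟨1, h1⟩).resolve_left fun h => by
      simpa using γ.eq_zero_of_bendPoint ha hb hd hD hp hbm ⟨1, h1⟩ h
    obtain ⟨y, hlast, hw', hr', hy, hyle, hc', hneg', hp1⟩ :=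
      γ.bend_on_second_axis ha hb hd hD hp hbm ⟨1, h1⟩ hpos1
    rw [show Fin.castSucc ⟨1, h1⟩ = Fin.succ ⟨0, hpos⟩ from rfl] at hw' hr' hyle hc' hneg'
    simp only [hw, hr, hc, Matrix.cons_val_zero, Matrix.cons_val_one] at hw' hr' hyle hc' hneg'
    have hM : (-(m₂ + a * x)) = -m₂ - a * x := by ring
    rw [hM] at hyle hc'
    have hne : (m₂ + a * x : ℝ) ≠ 0 := by exact_mod_cast hneg'.ne
    have hl : Fin.last γ.bends = Fin.succ ⟨1, h1⟩ := Fin.ext (by simp [← hlast])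
    -- The times are solved backwards from `p`: the last bend has q_1 = 0, the one before it has q_0
    -- = 0.
    have ht1 : γ.time ⟨1, h1⟩ = p 1 / (m₂ + a * x) := by
      have := γ.bendPoint_of_last ⟨1, h1⟩ hlast 1
      rw [hp1, hl, hw'] at this
      simp at this
      rw [eq_div_iff hne]
      linarith
    have ht0 : γ.time ⟨0, hpos⟩ = p 1 / (m₂ + a * x) +
        (p 0 - p 1 / (m₂ + a * x) * (m₁ + b * y)) / m₁ := by
      have e1 := γ.bendPoint_consecutive ⟨0, hpos⟩ ⟨1, h1⟩ rfl 0
      have e2 := γ.bendPoint_of_last ⟨1, h1⟩ hlast 0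
      rw [hl, hw'] at e2
      rw [h0, show Fin.castSucc ⟨1, h1⟩ = Fin.succ ⟨0, hpos⟩ from rfl, hw, e2, ht1] at e1
      simp at e1
      rw [← sub_eq_iff_eq_add', eq_div_iff hm1]
      linarith
    have hi : ∀ i : Fin (γ.bends + 1), i = 0 ∨ i = Fin.succ ⟨0, hpos⟩ ∨ i = Fin.succ ⟨1, h1⟩ := by
      intro i
      have := i.2
      simp only [Fin.ext_iff, Fin.val_zero, Fin.val_succ]
      simp only at hlast
      omega
    refine ⟨x, y, hxle, hyle, by simp [← hlast, lineBends, hy.ne'], fun j => ?_,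
      fun i => ?_, fun i => ?_, fun i => ?_⟩
    · have hj : j = ⟨0, hpos⟩ ∨ j = ⟨1, h1⟩ := by
        have := j.2
        simp only [Fin.ext_iff]
        simp only at hlast
        omega
      rcases hj with rfl | rfl
      · simp [ht0, lineTime, hy.ne']
      · simp [ht1, lineTime, hy.ne']
    · rcases hi i with rfl | rfl | rfl
      · simp [c0, lineCoeff]
      · rw [hc]
        simp [lineCoeff]
      · rw [hc']
        simp [lineCoeff]
    · rcases hi i with rfl | rfl | rfl
      · simp [w0, lineWt]
      · rw [hw]
        simp [lineWt]
      · rw [hw']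
        simp [lineWt]
    · rcases hi i with rfl | rfl | rfl
      · rw [r0, Fin.val_zero, lineRt_zero]
      · rw [hr]
        simp [lineRt]
      · rw [hr']
        simp [lineRt]
  · have hlast : 0 + 1 = γ.bends := by omega
    have hl : Fin.last γ.bends = Fin.succ ⟨0, hpos⟩ := Fin.ext (by simp [← hlast])
    have ht0 : γ.time ⟨0, hpos⟩ = p 0 / m₁ := by
      have := γ.bendPoint_of_last ⟨0, hpos⟩ hlast 0
      rw [h0, hl, hw] at this
      simp at this
      rw [eq_div_iff hm1]
      linarith
    have hi : ∀ i : Fin (γ.bends + 1), i = 0 ∨ i = Fin.succ ⟨0, hpos⟩ := by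
      intro i
      have := i.2
      simp only [Fin.ext_iff, Fin.val_zero, Fin.val_succ]
      omega
    refine ⟨x, 0, hxle, by simp, by simp [← hlast, lineBends, hx.ne'], fun j => ?_,
      fun i => ?_, fun i => ?_, fun i => ?_⟩
    · obtain rfl : j = ⟨0, hpos⟩ := Fin.ext (by omega)
      simp [ht0, lineTime]
    · rcases hi i with rfl | rfl
      · simp [c0, lineCoeff]
      · rw [hc]
        simp [lineCoeff]
    · rcases hi i with rfl | rfl
      · simp [w0, lineWt]
      · rw [hw]
        simp [lineWt]
    · rcases hi i with rfl | rfl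
      · rw [r0, Fin.val_zero, lineRt_zero]
      · rw [hr]
        simp [lineRt]

end Classification

/-! ### Construction of the broken lines -/

section Construction

variable {k : Type*} [Field k] [CharZero k] {a b : ℤ} (ha : a < 0) (hb : 0 < b)
  {d : Fin 2 → ℕ} (hd : IsSkewSymmetrizer !![0, b; a, 0] d) {ι : Type*}
  {D : ScatteringDiagram k d ι} (hD : IsTransposedClusterScattering !![0, b; a, 0] D)
  {p : Fin 2 → ℝ} (hp : IsGenericEndpoint d p) {m₁ m₂ : ℤ}

include hd in
omit [CharZero k] in
theorem notMem_intrinsicFrontier (D : ScatteringDiagram k d ι) {q : Fin 2 → ℝ} (hq : q ≠ 0)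
    (i : ι) : q ∉ intrinsicFrontier ℝ (D.wall i).carrier :=
  fun h => hq (Wall.intrinsicFrontier_subset hd.pos _ h)

include hd in
omit [CharZero k] in
theorem notMem_inter_of_ne_zero (D : ScatteringDiagram k d ι) {q : Fin 2 → ℝ} (hq : q ≠ 0)
    (i j : ι) (h : (D.wall i).root ≠ (D.wall j).root) :
    q ∉ (D.wall i).carrier ∩ (D.wall j).carrier :=
  fun hm => hq (Wall.eq_zero_of_mem_inter hd.pos _ _ h hm)

include hd hD in
/-- A broken line may bend when it crosses the coordinate axis `q i = 0` in negative direction. -/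
theorem exists_bend {q : Fin 2 → ℝ} (hq : q ≠ 0) {i : Fin 2} (hi : q i = 0)
    (hloc : D.localFn q = 1 + MvPowerSeries.X i) {w r : Fin 2 → ℤ} (hw : w i < 0) {m : ℕ}
    (hm : m ≤ (-w i).toNat) {c c' : k} (hc : c' = c * ((-w i).toNat.choose m : k))
    {w' r' : Fin 2 → ℤ} (hw' : w' = w + omegaVec !![0, b; a, 0] (Pi.single i m))
    (hr' : r' = r + Pi.single i (m : ℤ)) :
    ∃ v : Fin 2 → ℤ, Finset.univ.gcd v = 1 ∧
      (∀ l, q ∈ (D.wall l).carrier → ∀ q' ∈ (D.wall l).carrier, ∑ l, q' l * (v l : ℝ) = 0) ∧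
      0 < ∑ l, w l * v l ∧ ∃ e : Fin 2 →₀ ℕ, ∃ u : k, u ≠ 0 ∧
        u = MvPowerSeries.coeff e (D.localFn q ^ (∑ l, w l * v l).toNat) ∧ c' = c * u ∧
        w' = w + omegaVec !![0, b; a, 0] e ∧ r' = r + toQ e := by
  -- The normal is -α_i^∨, the sign being chosen so that it pairs positively with `w`.
  have hsum : ∑ l, w l * (Pi.single i (-1) : Fin 2 → ℤ) l = -w i := by
    simp [Pi.single_apply]
  refine ⟨Pi.single i (-1), ?_, fun l hl q' hq' => ?_, ?_, Finsupp.single i m,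
    ((-w i).toNat.choose m : k), ?_, ?_, hc, ?_, ?_⟩
  · rw [show (Finset.univ : Finset (Fin 2)) = {0, 1} from rfl, Finset.gcd_insert,
      Finset.gcd_singleton]
    fin_cases i <;> simp <;> rfl
  · have := coord_eq_zero_of_mem_wall hd hD hq hi hl hq'
    simp [Pi.single_apply, this]
  · rw [hsum]
    omega
  · exact_mod_cast (Nat.choose_pos hm).ne'
  · rw [hsum, hloc, coeff_one_add_X_pow i _ _ (by simp)]
    simp
  · rw [hw', Finsupp.single_eq_pi_single]
  · rw [hr', Finsupp.single_eq_pi_single]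
    congr 1
    funext l
    fin_cases i <;> fin_cases l <;> simp [toQ]

include hd hp in
omit [CharZero k] in
theorem exists_brokenLine_straight : ∃ γ : BrokenLine !![0, b; a, 0] D p ![m₁, m₂],
    γ.wt (Fin.last _) = ![m₁, m₂] ∧ γ.rt (Fin.last _) = ![0, 0] ∧ γ.coeff (Fin.last _) = 1 := by
  have hne : ∀ s : Set.Iic (0 : ℝ),
      (fun l => p l - s * (![m₁, m₂] : Fin 2 → ℤ) l : Fin 2 → ℝ) ≠ 0 :=
    fun s => hp.add_smul_ne_zero hd ![m₁, m₂] s fun l => rfl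
  exact ⟨{
    bends := 0
    time := Fin.elim0
    coeff := fun _ => 1
    wt := fun _ => ![m₁, m₂]
    rt := fun _ => ![0, 0]
    path := fun s l => p l - s * (![m₁, m₂] : Fin 2 → ℤ) l
    time_strictMono := fun i => i.elim0
    time_neg := fun i => i.elim0
    path_zero := by
      funext l
      simp
    avoids_boundaries := fun s i => notMem_intrinsicFrontier hd D (hne s) i
    avoids_intersections := fun s i j => notMem_inter_of_ne_zero hd D (hne s) i j
    linear := fun _ s s' _ _ l => by ring
    initial := ⟨rfl, rfl, by
      funext l
      fin_cases l <;> rfl⟩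
    nonlinear := fun i => i.elim0
    bend := fun i => i.elim0 }, rfl, rfl, rfl⟩

include ha hb hd hD hp in
theorem exists_brokenLine_one_bend {x : ℕ} (hx0 : 0 < x) (hx : x ≤ (-m₁).toNat) :
    ∃ γ : BrokenLine !![0, b; a, 0] D p ![m₁, m₂],
      γ.wt (Fin.last _) = ![m₁, m₂ + a * x] ∧ γ.rt (Fin.last _) = ![(x : ℤ), 0] ∧
      γ.coeff (Fin.last _) = ((-m₁).toNat.choose x : k) := by
  have hm1 : m₁ < 0 := by omega
  have hm1' : (m₁ : ℝ) < 0 := by exact_mod_cast hm1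
  have hp0 := hp.pos hd 0
  obtain ⟨t, ht⟩ : ∃ t, t = p 0 / m₁ := ⟨_, rfl⟩
  have htm : t * m₁ = p 0 := by rw [ht, div_mul_cancel₀ _ hm1'.ne]
  have ht0 : t < 0 := by rw [ht]; exact div_neg_of_pos_of_neg hp0 hm1'
  let w₀ : Fin 2 → ℤ := ![m₁, m₂]
  let w₁ : Fin 2 → ℤ := ![m₁, m₂ + a * x]
  -- Clamping the time with `max` and `min` encodes both segments in one formula.
  let f : Set.Iic (0 : ℝ) → Fin 2 → ℝ := fun s l =>
    p l - max (s : ℝ) t * w₁ l + (t - min (s : ℝ) t) * w₀ l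
  have hne : ∀ s, f s ≠ 0 := by
    intro s
    rcases le_or_gt t (s : ℝ) with h | h
    · refine hp.add_smul_ne_zero hd w₁ s fun l => ?_
      simp only [f, max_eq_left h, min_eq_right h]
      ring
    · intro h0
      have h0 : p 0 - max (s : ℝ) t * m₁ + (t - min (s : ℝ) t) * m₁ = 0 := congrFun h0 0
      rw [max_eq_right h.le, min_eq_left h.le, htm] at h0
      nlinarith
  have hft0 : ∀ h, f ⟨t, h⟩ 0 = 0 := by
    intro h
    change p 0 - max t t * m₁ + (t - min t t) * m₁ = 0
    rw [max_self, min_self, htm]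
    ring
  have hft1 : ∀ h, f ⟨t, h⟩ 1 ≠ 0 := fun h h1 => hne ⟨t, h⟩ (funext fun i => by
    fin_cases i
    · exact hft0 h
    · exact h1)
  exact ⟨{
    bends := 1
    time := ![t]
    coeff := ![1, ((-m₁).toNat.choose x : k)]
    wt := ![w₀, w₁]
    rt := ![0, ![(x : ℤ), 0]]
    path := f
    time_strictMono := fun i j hij => absurd hij (by simp [Subsingleton.elim i j])
    time_neg := fun i => by
      fin_cases i
      exact ht0
    path_zero := by
      funext l
      simp [f, max_eq_left ht0.le, min_eq_right ht0.le]
    avoids_boundaries := fun s i => notMem_intrinsicFrontier hd D (hne s) i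
    avoids_intersections := fun s i j => notMem_inter_of_ne_zero hd D (hne s) i j
    linear := fun i s s' h h' l => by
      fin_cases i
      · obtain ⟨h1, h2⟩ : (s : ℝ) ≤ t ∧ (s' : ℝ) ≤ t := h' 0 (Nat.zero_le _)
        simp only [f, max_eq_right h1, max_eq_right h2, min_eq_left h1, min_eq_left h2]
        change _ = ((s' : ℝ) - s) * -(w₀ l : ℝ)
        ring
      · obtain ⟨h1, h2⟩ : t ≤ (s : ℝ) ∧ t ≤ (s' : ℝ) := h 0 (Nat.zero_lt_one)
        simp only [f, max_eq_left h1, max_eq_left h2, min_eq_right h1, min_eq_right h2]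
        change _ = ((s' : ℝ) - s) * -(w₁ l : ℝ)
        ring
    initial := ⟨rfl, rfl, rfl⟩
    nonlinear := fun j => by
      fin_cases j
      intro h
      have h : m₂ = m₂ + a * x := congrFun h 1
      have : a * x < 0 := mul_neg_of_neg_of_pos ha (by exact_mod_cast hx0)
      omega
    bend := fun j => by
      fin_cases j
      refine exists_bend hd hD (i := 0) (m := x) (hne _) (hft0 _)
        (localFn_of_zero_eq_zero ha hb hd hD (hft0 _) (hft1 _)) hm1 hx ?_ ?_ ?_
      · exact (one_mul _).symm
      · change w₁ = w₀ + _
        rw [omegaVec_fin_two]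
        funext l
        fin_cases l <;> simp [w₀, w₁]
      · change ![(x : ℤ), 0] = 0 + _
        funext l
        fin_cases l <;> simp }, rfl, rfl, rfl⟩

include ha hb hd hD hp in
theorem exists_brokenLine_two_bends (hbm : -b ≤ m₁) {x y : ℕ} (hx0 : 0 < x)
    (hx : x ≤ (-m₁).toNat) (hy0 : 0 < y) (hy : y ≤ (-m₂ - a * x).toNat) :
    ∃ γ : BrokenLine !![0, b; a, 0] D p ![m₁, m₂],
      γ.wt (Fin.last _) = ![m₁ + b * y, m₂ + a * x] ∧ γ.rt (Fin.last _) = ![(x : ℤ), (y : ℤ)] ∧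
      γ.coeff (Fin.last _) =
        ((-m₁).toNat.choose x : k) * ((-m₂ - a * x).toNat.choose y : k) := by
  have hm1 : m₁ < 0 := by omega
  have hM : m₂ + a * x < 0 := by omega
  have hby : 0 ≤ m₁ + b * y := by
    have : b * 1 ≤ b * y := by gcongr; exact_mod_cast hy0
    linarith
  have hm1' : (m₁ : ℝ) < 0 := by exact_mod_cast hm1
  have hM' : (m₂ + a * x : ℝ) < 0 := by exact_mod_cast hM
  have hby' : (0 : ℝ) ≤ m₁ + b * y := by exact_mod_cast hby
  have hp0 := hp.pos hd 0
  have hp1 := hp.pos hd 1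
  obtain ⟨t, ht⟩ : ∃ t, t = p 1 / (m₂ + a * x) := ⟨_, rfl⟩
  have htm : t * (m₂ + a * x) = p 1 := by rw [ht, div_mul_cancel₀ _ hM'.ne]
  have ht0 : t < 0 := by rw [ht]; exact div_neg_of_pos_of_neg hp1 hM'
  -- `X` is the first coordinate at the bend on q_1 = 0; from there, going back with first exponent
  -- m₁ reaches q_0 = 0 at time `u`.
  obtain ⟨X, hX⟩ : ∃ X, X = p 0 - t * (m₁ + b * y) := ⟨_, rfl⟩
  have hX0 : 0 < X := by nlinarith
  obtain ⟨u, hu⟩ : ∃ u, u = t + X / m₁ := ⟨_, rfl⟩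
  have hum : (u - t) * m₁ = X := by
    rw [hu, add_sub_cancel_left, div_mul_cancel₀ _ hm1'.ne]
  have hut : u < t := by
    have := div_neg_of_pos_of_neg hX0 hm1'
    linarith
  let w₀ : Fin 2 → ℤ := ![m₁, m₂]
  let w₁ : Fin 2 → ℤ := ![m₁, m₂ + a * x]
  let w₂ : Fin 2 → ℤ := ![m₁ + b * y, m₂ + a * x]
  let f : Set.Iic (0 : ℝ) → Fin 2 → ℝ := fun s l =>
    p l - max (s : ℝ) t * w₂ l + (t - max (min (s : ℝ) t) u) * w₁ l + (u - min (s : ℝ) u) * w₀ l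
  have hf2 : ∀ s : Set.Iic (0 : ℝ), t ≤ (s : ℝ) → ∀ l, f s l = p l - s * w₂ l := by
    intro s h l
    simp only [f, max_eq_left h, min_eq_right h, max_eq_left hut.le, min_eq_right (hut.le.trans h)]
    ring
  have hf1 : ∀ s : Set.Iic (0 : ℝ), u ≤ (s : ℝ) → (s : ℝ) ≤ t → ∀ l,
      f s l = p l - t * w₂ l + (t - s) * w₁ l := by
    intro s h h' l
    simp only [f, max_eq_right h', min_eq_left h', max_eq_left h, min_eq_right h]
    ring
  have hf0 : ∀ s : Set.Iic (0 : ℝ), (s : ℝ) ≤ u → ∀ l,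
      f s l = p l - t * w₂ l + (t - u) * w₁ l + (u - s) * w₀ l := by
    intro s h l
    simp only [f, max_eq_right (h.trans hut.le), min_eq_left (h.trans hut.le), max_eq_right h,
      min_eq_left h]
  have hw20 : (w₂ 0 : ℝ) = m₁ + b * y := by simp [w₂]
  have hw21 : (w₂ 1 : ℝ) = m₂ + a * x := by simp [w₂]
  have hw11 : (w₁ 1 : ℝ) = m₂ + a * x := by simp [w₁]
  have hw10 : (w₁ 0 : ℝ) = m₁ := by simp [w₁]
  have hw00 : (w₀ 0 : ℝ) = m₁ := by simp [w₀]
  -- The origin is avoided on the last segment by genericity of `p`, on the middle one because q_1 <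
  -- 0 before time `t`, and on the first because q_0 < 0 before time `u`.
  have hne : ∀ s, f s ≠ 0 := by
    intro s
    rcases le_or_gt t (s : ℝ) with h | h
    · exact hp.add_smul_ne_zero hd w₂ s (hf2 s h)
    · rcases le_or_gt u (s : ℝ) with h' | h'
      · intro h0
        have e := hf1 s h' h.le 1
        rw [h0, hw21, hw11, htm, Pi.zero_apply] at e
        nlinarith
      · intro h0
        have e := hf0 s h'.le 0
        rw [h0, hw20, hw10, hw00, Pi.zero_apply] at e
        nlinarith
  have hft1 : ∀ h, f ⟨t, h⟩ 1 = 0 := by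
    intro h
    rw [hf2 _ le_rfl, hw21, htm, sub_self]
  have hft0 : ∀ h, 0 < f ⟨t, h⟩ 0 := by
    intro h
    rw [hf2 _ le_rfl, hw20, ← hX]
    exact hX0
  have hfu0 : ∀ h, f ⟨u, h⟩ 0 = 0 := by
    intro h
    rw [hf1 _ le_rfl hut.le, hw20, hw10, ← hX]
    linear_combination -hum
  have hfu1 : ∀ h, f ⟨u, h⟩ 1 ≠ 0 := fun h h1 => hne ⟨u, h⟩ (funext fun i => by
    fin_cases i
    · exact hfu0 h
    · exact h1)
  have hax : a * x < 0 := mul_neg_of_neg_of_pos ha (by exact_mod_cast hx0)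
  have hby0 : 0 < b * y := mul_pos hb (by exact_mod_cast hy0)
  exact ⟨{
    bends := 2
    time := ![u, t]
    coeff := ![1, ((-m₁).toNat.choose x : k),
      ((-m₁).toNat.choose x : k) * ((-m₂ - a * x).toNat.choose y : k)]
    wt := ![w₀, w₁, w₂]
    rt := ![0, ![(x : ℤ), 0], ![(x : ℤ), (y : ℤ)]]
    path := f
    time_strictMono := fun i j hij => by
      fin_cases i <;> fin_cases j
      · exact absurd hij (lt_irrefl _)
      · exact hut
      · exact absurd hij (by simp)
      · exact absurd hij (lt_irrefl _)
    time_neg := fun i => by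
      fin_cases i
      · exact hut.trans ht0
      · exact ht0
    path_zero := by
      funext l
      rw [hf2 _ ht0.le]
      simp
    avoids_boundaries := fun s i => notMem_intrinsicFrontier hd D (hne s) i
    avoids_intersections := fun s i j => notMem_inter_of_ne_zero hd D (hne s) i j
    linear := fun i s s' h h' l => by
      fin_cases i
      · obtain ⟨h1, h2⟩ : (s : ℝ) ≤ u ∧ (s' : ℝ) ≤ u := h' 0 (Nat.zero_le _)
        rw [hf0 s h1, hf0 s' h2]
        change _ = ((s' : ℝ) - s) * -(w₀ l : ℝ)
        ring
      · obtain ⟨h1, h2⟩ : u ≤ (s : ℝ) ∧ u ≤ (s' : ℝ) := h 0 Nat.zero_lt_one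
        obtain ⟨h3, h4⟩ : (s : ℝ) ≤ t ∧ (s' : ℝ) ≤ t := h' 1 le_rfl
        rw [hf1 s h1 h3, hf1 s' h2 h4]
        change _ = ((s' : ℝ) - s) * -(w₁ l : ℝ)
        ring
      · obtain ⟨h1, h2⟩ : t ≤ (s : ℝ) ∧ t ≤ (s' : ℝ) := h 1 (Nat.lt_succ_self 1)
        rw [hf2 s h1, hf2 s' h2]
        change _ = ((s' : ℝ) - s) * -(w₂ l : ℝ)
        ring
    initial := ⟨rfl, rfl, rfl⟩
    nonlinear := fun j => by
      fin_cases j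
      · intro h
        have h : m₂ = m₂ + a * x := congrFun h 1
        omega
      · intro h
        have h : m₁ = m₁ + b * y := congrFun h 0
        omega
    bend := fun j => by
      fin_cases j
      · refine exists_bend hd hD (i := 0) (m := x) (hne _) (hfu0 _)
          (localFn_of_zero_eq_zero ha hb hd hD (hfu0 _) (hfu1 _)) hm1 hx ?_ ?_ ?_
        · exact (one_mul _).symm
        · change w₁ = w₀ + _
          rw [omegaVec_fin_two]
          funext l
          fin_cases l <;> simp [w₀, w₁]
        · change ![(x : ℤ), 0] = 0 + _
          funext l
          fin_cases l <;> simp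
      · have hMe : -(m₂ + a * x) = -m₂ - a * x := by ring
        refine exists_bend hd hD (i := 1) (m := y) (hne _) (hft1 _)
          (localFn_of_one_eq_zero ha hb hd hD (hft0 _) (hft1 _)) hM ?_ ?_ ?_ ?_
        · change y ≤ (-(m₂ + a * x)).toNat
          rwa [hMe]
        · change _ * _ = _ * (((-(m₂ + a * x)).toNat.choose y : ℕ) : k)
          rw [hMe]
          rfl
        · change w₂ = w₁ + _
          rw [omegaVec_fin_two]
          funext l
          fin_cases l <;> simp [w₁, w₂]
        · change ![(x : ℤ), (y : ℤ)] = ![(x : ℤ), 0] + _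
          funext l
          fin_cases l <;> simp }, rfl, rfl, rfl⟩

end Construction

/-! ### Laurent polynomials and the exchanged variable -/

section Laurent

variable {k : Type*} [Field k]

theorem monomial_mul_monomial {n : ℕ} (l l' β β' : Fin n → ℤ) :
    monomial k l β * monomial k l' β' = monomial k (l + l') (β + β') := by
  rw [monomial, monomial, monomial, AddMonoidAlgebra.single_mul_single, one_mul]
  rfl

theorem monomial_pow {n : ℕ} (l β : Fin n → ℤ) (j : ℕ) :
    monomial k l β ^ j = monomial k (j • l) (j • β) := by
  rw [monomial, monomial, AddMonoidAlgebra.single_pow, one_pow]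
  rfl

theorem natCast_mul_monomial {n : ℕ} (l β : Fin n → ℤ) (c : ℕ) :
    (c : LaurentRing k n) * monomial k l β = AddMonoidAlgebra.single (l, β) (c : k) := by
  rw [← nsmul_eq_mul, monomial, AddMonoidAlgebra.smul_single, nsmul_eq_mul, mul_one]

theorem exchangedVariable_eq {a b : ℤ} (hb : 0 < b) :
    exchangedVariable k !![0, b; a, 0] 1 =
      (1 + monomial k ![b, 0] ![0, 1]) * monomial k ![0, -1] 0 := by
  have e1 : ∏ i, extendedCluster k i ^
      (Matrix.fromRows (!![0, b; a, 0]) (1 : Matrix (Fin 2) (Fin 2) ℤ) i 1).toNat =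
      monomial k ![b, 0] ![0, 1] := by
    simp [Fintype.prod_sum_type, Fin.prod_univ_two, extendedCluster, monomial_pow,
      monomial_mul_monomial]
    congr 1
    · funext i
      fin_cases i <;> simp [hb.le]
    · funext i
      fin_cases i <;> simp
  -- The exchanged column (b, 0, 0, 1) has no negative entry.
  have e2 : ∏ i, extendedCluster k i ^
      (-(Matrix.fromRows (!![0, b; a, 0]) (1 : Matrix (Fin 2) (Fin 2) ℤ) i 1)).toNat = 1 := by
    have hb' : (-b).toNat = 0 := by omega
    simp [Fintype.prod_sum_type, Fin.prod_univ_two, extendedCluster, hb']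
  have e3 : -(Pi.single 1 1 : Fin 2 → ℤ) = ![0, -1] := by
    funext i
    fin_cases i <;> simp
  rw [exchangedVariable, e1, e2, e3]
  ring

theorem sum_first_form (a b m₁ m₂ : ℤ) (e : (Fin 2 → ℤ) × (Fin 2 → ℤ)) :
    (∑ i ∈ Finset.range ((-m₁).toNat + 1),
        ((-m₁).toNat.choose i : LaurentRing k 2) * monomial k ![m₁, m₂ + a * i] ![(i : ℤ), 0] *
          (1 + monomial k ![b, 0] ![0, 1]) ^ (-m₂ - a * i).toNat).coeff e =
    ∑ i ∈ Finset.range ((-m₁).toNat + 1), ∑ j ∈ Finset.range ((-m₂ - a * i).toNat + 1),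
      if (![m₁ + b * j, m₂ + a * i], ![(i : ℤ), (j : ℤ)]) = e then
        ((-m₁).toNat.choose i : k) * ((-m₂ - a * i).toNat.choose j : k) else 0 := by
  classical
  rw [AddMonoidAlgebra.coeff_sum, Finsupp.finsetSum_apply]
  refine Finset.sum_congr rfl fun i _ => ?_
  rw [add_comm (1 : LaurentRing k 2), add_pow, Finset.mul_sum, AddMonoidAlgebra.coeff_sum,
    Finsupp.finsetSum_apply]
  refine Finset.sum_congr rfl fun j _ => ?_
  have : ((-m₁).toNat.choose i : LaurentRing k 2) * monomial k ![m₁, m₂ + a * i] ![(i : ℤ), 0] *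
      (monomial k ![b, 0] ![0, 1] ^ j * 1 ^ ((-m₂ - a * i).toNat - j) *
        ((-m₂ - a * i).toNat.choose j : LaurentRing k 2)) =
      AddMonoidAlgebra.single (![m₁ + b * j, m₂ + a * i], ![(i : ℤ), (j : ℤ)])
        (((-m₁).toNat.choose i * (-m₂ - a * i).toNat.choose j : ℕ) : k) := by
    rw [← natCast_mul_monomial, one_pow, mul_one, monomial_pow]
    have : monomial k ![m₁ + b * j, m₂ + a * i] ![(i : ℤ), (j : ℤ)] =
        monomial k ![m₁, m₂ + a * i] ![(i : ℤ), 0] * monomial k (j • ![b, 0]) (j • ![0, 1]) := by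
      rw [monomial_mul_monomial]
      congr 1
      · funext l
        fin_cases l <;> simp [mul_comm]
      · funext l
        fin_cases l <;> simp
    rw [this]
    push_cast
    ring
  rw [this, AddMonoidAlgebra.coeff_single, Finsupp.single_apply]
  push_cast
  rfl

theorem sum_second_form {a b : ℤ} (hb : 0 < b) (m₁ m₂ : ℤ) :
    ∑ i ∈ Finset.range ((-m₁).toNat + 1),
        ((-m₁).toNat.choose i : LaurentRing k 2) * monomial k 0 ![(i : ℤ), 0] *
          exchangedVariable k !![0, b; a, 0] 1 ^ (-m₂ - a * i).toNat *
          monomial k ![m₁, max (m₂ + a * i) 0] 0 =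
    ∑ i ∈ Finset.range ((-m₁).toNat + 1),
        ((-m₁).toNat.choose i : LaurentRing k 2) * monomial k ![m₁, m₂ + a * i] ![(i : ℤ), 0] *
          (1 + monomial k ![b, 0] ![0, 1]) ^ (-m₂ - a * i).toNat := by
  refine Finset.sum_congr rfl fun i _ => ?_
  -- Splitting n = m₂ + a i as [n]_+ - [-n]_+ supplies the powers of x_1⁻¹ that turn 1 + y_1 x_0^b
  -- into the exchanged variable.
  have : monomial k ![m₁, m₂ + a * i] ![(i : ℤ), 0] = monomial k 0 ![(i : ℤ), 0] *
      (monomial k ![0, -1] 0 ^ (-m₂ - a * i).toNat * monomial k ![m₁, max (m₂ + a * i) 0] 0) := by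
    rw [monomial_pow, monomial_mul_monomial, monomial_mul_monomial]
    congr 1
    · funext l
      fin_cases l
      · simp
      · simp
        omega
    · funext l
      fin_cases l <;> simp
  rw [this, exchangedVariable_eq hb, mul_pow]
  ring

end Laurent

/-! ### The theta function -/

section Theta

variable {k : Type*} [Field k] {a b : ℤ} (ha : a < 0) (hb : 0 < b)
  {d : Fin 2 → ℕ} (hd : IsSkewSymmetrizer !![0, b; a, 0] d) {ι : Type*}
  {D : ScatteringDiagram k d ι} (hD : IsTransposedClusterScattering !![0, b; a, 0] D)
  {p : Fin 2 → ℝ} (hp : IsGenericEndpoint d p) {m₁ m₂ : ℤ} (hbm : -b ≤ m₁) (hm₂ : 0 ≤ m₂)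

-- Without a bend on the first axis the second exponent remains m₂ ≥ 0, which rules out a bend on
-- the second.
include hm₂ in
theorem pos_of_le_toNat {x y : ℕ} (hy : y ≤ (-m₂ - a * x).toNat) (hy0 : 0 < y) : 0 < x := by
  rw [Nat.pos_iff_ne_zero]
  rintro rfl
  simp at hy
  omega

include ha hb hd hD hp hbm hm₂

theorem BrokenLine.final_data (γ : BrokenLine !![0, b; a, 0] D p ![m₁, m₂]) :
    ∃ x y : ℕ, x ≤ (-m₁).toNat ∧ y ≤ (-m₂ - a * x).toNat ∧
      γ.wt (Fin.last _) = ![m₁ + b * y, m₂ + a * x] ∧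
      γ.rt (Fin.last _) = ![(x : ℤ), (y : ℤ)] := by
  obtain ⟨x, y, hx, hy, hbd, -, -, hw, hr⟩ := γ.classification ha hb hd hD hp hbm hm₂
  refine ⟨x, y, hx, hy, ?_⟩
  rw [hw, hr, Fin.val_last, hbd]
  rcases Nat.eq_zero_or_pos y with rfl | hy0
  · rcases Nat.eq_zero_or_pos x with rfl | hx0
    · simp [lineBends, lineWt, lineRt]
    · simp [lineBends, lineWt, lineRt, hx0.ne']
  · simp [lineBends, lineWt, lineRt, hy0.ne']

/-- A broken line is determined by its final `y`-exponent. -/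
theorem BrokenLine.eq_of_rt_last (γ γ' : BrokenLine !![0, b; a, 0] D p ![m₁, m₂])
    (h : γ.rt (Fin.last _) = γ'.rt (Fin.last _)) : γ = γ' := by
  obtain ⟨x, y, -, hy, hbd, ht, hc, hw, hr⟩ := γ.classification ha hb hd hD hp hbm hm₂
  obtain ⟨x', y', -, hy', hbd', ht', hc', hw', hr'⟩ := γ'.classification ha hb hd hD hp hbm hm₂
  have key : ∀ {x y : ℕ}, y ≤ (-m₂ - a * x).toNat → lineRt x y (lineBends x y) = ![(x : ℤ), y] := by
    intro x y hy
    rcases Nat.eq_zero_or_pos y with rfl | hy0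
    · rcases Nat.eq_zero_or_pos x with rfl | hx0
      · simp [lineBends, lineRt]
      · simp [lineBends, lineRt, hx0.ne']
    · simp [lineBends, lineRt, hy0.ne']
  rw [hr, hr', Fin.val_last, Fin.val_last, hbd, hbd', key hy, key hy'] at h
  obtain rfl : x = x' := by simpa using congrFun h 0
  obtain rfl : y = y' := by simpa using congrFun h 1
  exact BrokenLine.eq_of_data γ γ' (hbd.trans hbd'.symm) (fun j => by rw [ht, ht']; rfl)
    (fun j => by rw [hc, hc']; rfl) (fun j => by rw [hw, hw']; rfl)
    (fun j => by rw [hr, hr']; rfl)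

theorem finite_brokenLine : Finite (BrokenLine !![0, b; a, 0] D p ![m₁, m₂]) := by
  have hfin : (⋃ x ∈ Finset.range ((-m₁).toNat + 1),
      (fun y : ℕ => (![(x : ℤ), (y : ℤ)] : Fin 2 → ℤ)) ''
        (Finset.range ((-m₂ - a * x).toNat + 1))).Finite :=
    (Finset.finite_toSet _).biUnion fun x _ => (Finset.finite_toSet _).image _
  have := hfin.to_subtype
  refine Finite.of_injective (fun γ : BrokenLine !![0, b; a, 0] D p ![m₁, m₂] =>
    (⟨γ.rt (Fin.last _), ?_⟩ : ↥(⋃ x ∈ Finset.range ((-m₁).toNat + 1),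
      (fun y : ℕ => (![(x : ℤ), (y : ℤ)] : Fin 2 → ℤ)) ''
        (Finset.range ((-m₂ - a * x).toNat + 1))))) ?_
  · obtain ⟨x, y, hx, hy, -, hr⟩ := γ.final_data ha hb hd hD hp hbm hm₂
    simp only [Set.mem_iUnion]
    exact ⟨x, Finset.mem_range.2 (by omega), y, by simpa using Nat.lt_succ_of_le hy, hr.symm⟩
  · intro γ γ' h
    exact γ.eq_of_rt_last ha hb hd hD hp hbm hm₂ γ' (congrArg Subtype.val h)

theorem exists_brokenLine [CharZero k] {x y : ℕ} (hx : x ≤ (-m₁).toNat)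
    (hy : y ≤ (-m₂ - a * x).toNat) :
    ∃ γ : BrokenLine !![0, b; a, 0] D p ![m₁, m₂],
      γ.wt (Fin.last _) = ![m₁ + b * y, m₂ + a * x] ∧ γ.rt (Fin.last _) = ![(x : ℤ), (y : ℤ)] ∧
      γ.coeff (Fin.last _) =
        ((-m₁).toNat.choose x : k) * ((-m₂ - a * x).toNat.choose y : k) := by
  rcases Nat.eq_zero_or_pos y with rfl | hy0
  · rcases Nat.eq_zero_or_pos x with rfl | hx0
    · simpa using exists_brokenLine_straight hd hp
    · simpa using exists_brokenLine_one_bend ha hb hd hD hp hx0 hx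
  · exact exists_brokenLine_two_bends ha hb hd hD hp hbm (pos_of_le_toNat hm₂ hy hy0) hx hy0 hy

/-- The final y-exponent (x, y) determines the broken line, so the sum defining each coefficient of
the theta function has at most one term. -/
theorem theta_eq_sum [CharZero k] (e : (Fin 2 → ℤ) × (Fin 2 → ℤ)) :
    theta !![0, b; a, 0] D p ![m₁, m₂] e =
    ∑ i ∈ Finset.range ((-m₁).toNat + 1), ∑ j ∈ Finset.range ((-m₂ - a * i).toNat + 1),
      if (![m₁ + b * j, m₂ + a * i], ![(i : ℤ), (j : ℤ)]) = e then
        ((-m₁).toNat.choose i : k) * ((-m₂ - a * i).toNat.choose j : k) else 0 := by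
  by_cases h : ∃ x y : ℕ, x ≤ (-m₁).toNat ∧ y ≤ (-m₂ - a * x).toNat ∧
      (![m₁ + b * y, m₂ + a * x], ![(x : ℤ), (y : ℤ)]) = e
  · obtain ⟨x, y, hx, hy, rfl⟩ := h
    obtain ⟨γ, hw, hr, hc⟩ := exists_brokenLine ha hb hd hD hp hbm hm₂ hx hy
    have hne : ∀ i j : ℕ, (i ≠ x ∨ j ≠ y) →
        ¬ ((![m₁ + b * j, m₂ + a * i], ![(i : ℤ), (j : ℤ)]) : (Fin 2 → ℤ) × (Fin 2 → ℤ)) =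
          (![m₁ + b * y, m₂ + a * x], ![(x : ℤ), (y : ℤ)]) := by
      intro i j hij h
      have h2 := (Prod.ext_iff.1 h).2
      have h0 : i = x := by simpa using congrFun h2 0
      have h1 : j = y := by simpa using congrFun h2 1
      exact hij.elim (fun h => h h0) fun h => h h1
    rw [Finset.sum_eq_single x, Finset.sum_eq_single y, if_pos rfl, theta]
    · rw [finsum_eq_single _ ⟨γ, by rw [hw, hr]⟩, hc]
      rintro ⟨γ', hγ'⟩ hne'
      refine absurd (Subtype.ext ?_) hne'
      refine γ'.eq_of_rt_last ha hb hd hD hp hbm hm₂ γ ?_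
      rw [hr]
      exact congrArg Prod.snd hγ'
    · intro j _ hj
      rw [if_neg (hne x j (Or.inr hj))]
    · intro hy'
      exact absurd (Finset.mem_range.2 (by omega)) hy'
    · intro i _ hi
      exact Finset.sum_eq_zero fun j _ => if_neg (hne i j (Or.inl hi))
    · intro hx'
      exact absurd (Finset.mem_range.2 (by omega)) hx'
  · have hempty : IsEmpty {γ : BrokenLine !![0, b; a, 0] D p ![m₁, m₂] //
        (γ.wt (Fin.last _), γ.rt (Fin.last _)) = e} := by
      refine ⟨fun γ => h ?_⟩
      obtain ⟨x, y, hx, hy, hw, hr⟩ := γ.1.final_data ha hb hd hD hp hbm hm₂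
      exact ⟨x, y, hx, hy, by rw [← hw, ← hr, γ.2]⟩
    rw [theta, finsum_of_isEmpty]
    refine (Finset.sum_eq_zero fun i hi => Finset.sum_eq_zero fun j hj => if_neg fun he => ?_).symm
    rw [Finset.mem_range] at hi hj
    exact h ⟨i, j, by omega, by omega, he⟩

end Theta

end ClusterScattering

theorem mainTheorem9 {k : Type*} [Field k] [CharZero k] (a b : ℤ) (ha : a < 0) (hb : 0 < b)
    (d : Fin 2 → ℕ) (hd : IsSkewSymmetrizer !![0, b; a, 0] d)
    {ι : Type*} (D : ScatteringDiagram k d ι) (hD : IsTransposedClusterScattering !![0, b; a, 0] D)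
    (p : Fin 2 → ℝ) (hp : IsGenericEndpoint d p)
    (m₁ m₂ : ℤ) (hbm : -b ≤ m₁) (hm₁ : m₁ ≤ 0) (hm₂ : 0 ≤ m₂) :
    Finite (BrokenLine !![0, b; a, 0] D p ![m₁, m₂]) ∧
    theta !![0, b; a, 0] D p ![m₁, m₂] =
      (∑ i ∈ Finset.range ((-m₁).toNat + 1),
        ((-m₁).toNat.choose i : LaurentRing k 2) * monomial k ![m₁, m₂ + a * i] ![(i : ℤ), 0] *
          (1 + monomial k ![b, 0] ![0, 1]) ^ (-m₂ - a * i).toNat).coeff ∧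
    theta !![0, b; a, 0] D p ![m₁, m₂] =
      (∑ i ∈ Finset.range ((-m₁).toNat + 1),
        ((-m₁).toNat.choose i : LaurentRing k 2) * monomial k 0 ![(i : ℤ), 0] *
          exchangedVariable k !![0, b; a, 0] 1 ^ (-m₂ - a * i).toNat *
          monomial k ![m₁, max (m₂ + a * i) 0] 0).coeff ∧
    exchangedVariable k !![0, b; a, 0] 1 =
      (1 + monomial k ![b, 0] ![0, 1]) * monomial k ![0, -1] 0 := by
  have h1 : theta !![0, b; a, 0] D p ![m₁, m₂] =
      (∑ i ∈ Finset.range ((-m₁).toNat + 1),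
        ((-m₁).toNat.choose i : LaurentRing k 2) * monomial k ![m₁, m₂ + a * i] ![(i : ℤ), 0] *
          (1 + monomial k ![b, 0] ![0, 1]) ^ (-m₂ - a * i).toNat).coeff := by
    funext e
    rw [sum_first_form]
    exact theta_eq_sum ha hb hd hD hp hbm hm₂ e
  refine ⟨finite_brokenLine ha hb hd hD hp hbm hm₂, h1, ?_, exchangedVariable_eq hb⟩
  rw [sum_second_form hb]
  exact h1
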